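/- Let $C$ be an algebraically closed field of characteristic zero, $K=C(x)$ with the derivation $D=d/dx$, and let $K[D]$ be the ring of linear differential operators $p_0+p_1D+\cdots+p_rD^r$ with $p_i\in K$ (of order $r$ if $p_r\neq 0$), where $Da=aD+a'$ for $a\in K$. For operators $L,M$, let $\mathrm{lclm}(L,M)$ be the monic operator of lowest order having both $L$ and $M$ as right factors; let $L\otimes M$ be the monic operator of lowest order that annihilates $fg$ whenever $f$ is a solution of $L$ and $g$ is a solution of $M$ in some differential field extension of $K$; and for $s\ge 1$ let $L^{\otimes s}=L\otimes\cdots\otimes L$ ($s$ factors), with $L^{\otimes 1}=L$. For $\xi\in C\cup\{\infty\}$, a Puiseux series at $\xi$ is a series with coefficients in $C$ in powers of $(x-\xi)^{1/q}$ (of $x^{-1/q}$ if $\xi=\infty$), for some integer $q\ge1$, with finitely many negative exponents; it is integral if it is zero or its starting exponent is nonnegative. A class $[P]_L\in K[D]/\langle L\rangle$, where $\langle L\rangle=K[D]L$, is completely integral if for every $\xi\in C\cup\{\infty\}$ and every Puiseux series solution $f$ of $L$ at $\xi$ the series $P\cdot f$ is integral. It is a constant if $D\cdot[P]_L=0$ in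 $K[D]/\langle L\rangle$, and a pseudoconstant if it is completely integral but not a constant. We say that $L$ has a pseudoconstant if $K[D]/\langle L\rangle$ contains one. **Proposition.** Let $L,M\in K[D]$ be nonzero operators. Assume that at every point $\xi\in C\cup\{\infty\}$ the operator $L$ has a basis of Puiseux series solutions, i.e. $\mathrm{ord}(L)$ many $C$-linearly independent ones, and that $M$ has only rational solutions, i.e. the solution space of $M$ in $K$ has $C$-dimension $\mathrm{ord}(M)$. Let $s\ge1$ be an integer. If $\mathrm{lclm}(L,M)^{\otimes s}$ has a pseudoconstant, then there is a $d\in\{1,\dots,s\}$ such that $L^{\otimes d}$ has a pseudoconstant. -/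

import Mathlib

open scoped Differential

set_option linter.unusedSectionVars false

universe u

/-! ### The ring `K[D]` of linear differential operators over a differential field -/

section PolynomialLevel

open Polynomial

variable {K : Type u} [Field K]

/-- `p₀ f + p₁ δ(f) + ⋯ + p_r δ^r(f)` for a polynomial `p₀ + p₁ X + ⋯ + p_r X^r`. -/
noncomputable def polyAct {V : Type*} [AddCommGroup V] [Module K V] (δ : V →+ V) (P : K[X]) :
    V →+ V where
  toFun f := P.sum fun i p => p • (δ^[i] f)
  map_zero' := by simp [Polynomial.sum_def]
  map_add' f g := by
    simp only [Polynomial.sum_def, ← Finset.sum_add_distrib]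
    refine Finset.sum_congr rfl fun i _ => ?_
    rw [iterate_map_add, smul_add]

section

variable {V : Type*} [AddCommGroup V] [Module K V] (δ : V →+ V)

theorem polyAct_apply (P : K[X]) (f : V) :
    polyAct δ P f = P.sum fun i p => p • (δ^[i] f) := rfl

theorem polyAct_add (P Q : K[X]) (f : V) :
    polyAct δ (P + Q) f = polyAct δ P f + polyAct δ Q f :=
  Polynomial.sum_add_index P Q (fun i p => p • (δ^[i] f)) (by simp) (by intros; rw [add_smul])

theorem polyAct_zero (f : V) : polyAct δ (0 : K[X]) f = 0 :=
  Polynomial.sum_zero_index fun i (p : K) => p • (δ^[i] f)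

theorem polyAct_monomial (i : ℕ) (a : K) (f : V) :
    polyAct δ (monomial i a) f = a • (δ^[i] f) :=
  Polynomial.sum_monomial_index a (fun i p => p • (δ^[i] f)) (by simp)

theorem polyAct_smul (a : K) (P : K[X]) (f : V) :
    polyAct δ (a • P) f = a • polyAct δ P f := by
  rw [polyAct_apply, polyAct_apply, Polynomial.sum_smul_index _ _ _ (by simp),
    Polynomial.sum_def, Polynomial.sum_def, Finset.smul_sum]
  simp only [mul_smul]

end

variable [Differential K]

/-- Left multiplication by `D`, that is `∑ p_i D^i ↦ ∑ (p_i′ D^i + p_i D^(i+1))`. -/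
noncomputable def polyLeftD : K[X] →+ K[X] where
  toFun Q := Differential.mapCoeffs Q + X * Q
  map_zero' := by simp
  map_add' P Q := by rw [map_add]; ring

theorem polyLeftD_apply (Q : K[X]) : polyLeftD Q = Differential.mapCoeffs Q + X * Q := rfl

theorem polyLeftD_monomial (i : ℕ) (a : K) :
    polyLeftD (monomial i a) = monomial i a′ + monomial (i + 1) a := by
  rw [polyLeftD_apply, Polynomial.X_mul_monomial, Differential.mapCoeffs_monomial]

theorem polyLeftD_smul (a : K) (Q : K[X]) :
    polyLeftD (a • Q) = a′ • Q + a • polyLeftD Q := by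
  simp only [polyLeftD_apply, Polynomial.smul_eq_C_mul]
  rw [Derivation.leibniz, Differential.mapCoeffs_C]
  simp only [smul_eq_mul]
  ring

theorem polyAct_polyLeftD {V : Type*} [AddCommGroup V] [Module K V] (δ : V →+ V)
    (hδ : ∀ (a : K) (v : V), δ (a • v) = a′ • v + a • δ v) (Q : K[X]) (f : V) :
    polyAct δ (polyLeftD Q) f = δ (polyAct δ Q f) := by
  induction Q using Polynomial.induction_on' with
  | add p q hp hq => rw [map_add, polyAct_add, hp, hq, polyAct_add, map_add]
  | monomial n a =>
    rw [polyLeftD_monomial, polyAct_add, polyAct_monomial, polyAct_monomial, polyAct_monomial, hδ,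
      Function.iterate_succ_apply']

/-- The action is compatible with the product, for every operator `δ` satisfying the Leibniz
rule. -/
theorem polyAct_mul {V : Type*} [AddCommGroup V] [Module K V] (δ : V →+ V)
    (hδ : ∀ (a : K) (v : V), δ (a • v) = a′ • v + a • δ v) (P Q : K[X]) (f : V) :
    polyAct δ (polyAct polyLeftD P Q) f = polyAct δ P (polyAct δ Q f) := by
  have iter (i : ℕ) : polyAct δ (polyLeftD^[i] Q) f = δ^[i] (polyAct δ Q f) := by
    induction i with
    | zero => rfl
    | succ i ih =>
      rw [Function.iterate_succ_apply', polyAct_polyLeftD δ hδ, ih, Function.iterate_succ_apply']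
  induction P using Polynomial.induction_on' with
  | add p q hp hq => rw [polyAct_add, polyAct_add, hp, hq, polyAct_add]
  | monomial n a => rw [polyAct_monomial, polyAct_monomial, polyAct_smul, iter]

theorem polyAct_polyLeftD_one (P : K[X]) : polyAct polyLeftD P 1 = P := by
  have iter (i : ℕ) : polyLeftD^[i] (1 : K[X]) = monomial i 1 := by
    induction i with
    | zero => rfl
    | succ i ih => rw [Function.iterate_succ_apply', ih, polyLeftD_monomial]; simp
  induction P using Polynomial.induction_on' with
  | add p q hp hq => rw [polyAct_add, hp, hq]
  | monomial n a => rw [polyAct_monomial, iter, Polynomial.smul_monomial]; simp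

end PolynomialLevel

/-- Linear differential operators `p₀ + p₁ D + ⋯ + p_r D^r` with coefficients in `K`, written with
the coefficients on the left and stored as the polynomial `p₀ + p₁ X + ⋯ + p_r X^r`.  The product
defined below is not the one of polynomials: it satisfies `D * a = a * D + a′`. -/
def DiffOp (K : Type u) [Field K] : Type u := Polynomial K

namespace DiffOp

variable {K : Type u} [Field K]

noncomputable instance : AddCommGroup (DiffOp K) := inferInstanceAs (AddCommGroup (Polynomial K))

/-- The polynomial with the same coefficients. -/
def toPoly (L : DiffOp K) : Polynomial K := L

/-- The operator with the same coefficients as a polynomial. -/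
def ofPoly (P : Polynomial K) : DiffOp K := P

/-- The order `r` of a nonzero operator `p₀ + p₁ D + ⋯ + p_r D^r`, `p_r ≠ 0`. -/
def order (L : DiffOp K) : ℕ := L.toPoly.natDegree

/-- An operator is monic if its leading coefficient is `1`. -/
def IsMonic (L : DiffOp K) : Prop := L.toPoly.Monic

/-- The operator `D`. -/
noncomputable def D : DiffOp K := ofPoly Polynomial.X

/-- An element of `K` as an operator. -/
noncomputable def const (a : K) : DiffOp K := ofPoly (Polynomial.C a)

/-- The action `L · f = p₀ f + p₁ f′ + ⋯ + p_r f^(r)` on a differential field `F` over `K`. -/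
noncomputable def apply {F : Type*} [Field F] [Differential F] [Algebra K F] (L : DiffOp K)
    (f : F) : F :=
  L.toPoly.sum fun i p => p • ((fun g : F => g′)^[i] f)

variable [Differential K]

noncomputable instance : One (DiffOp K) := ⟨ofPoly 1⟩

/-- `(∑ p_i D^i) * Q = ∑ p_i (D^i Q)`, with `D Q` given by `polyLeftD`. -/
noncomputable instance : Mul (DiffOp K) := ⟨fun P Q => ofPoly (polyAct polyLeftD P.toPoly Q.toPoly)⟩

theorem mul_def (P Q : DiffOp K) : P * Q = ofPoly (polyAct polyLeftD P.toPoly Q.toPoly) := rfl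

theorem one_mul_aux (P : DiffOp K) : 1 * P = P :=
  (polyAct_monomial (V := Polynomial K) polyLeftD 0 1 P.toPoly).trans (one_smul K P.toPoly)

theorem mul_assoc_aux (P Q R : DiffOp K) : P * Q * R = P * (Q * R) :=
  polyAct_mul (V := Polynomial K) polyLeftD polyLeftD_smul P.toPoly Q.toPoly R.toPoly

theorem add_mul_aux (P Q R : DiffOp K) : (P + Q) * R = P * R + Q * R :=
  polyAct_add (V := Polynomial K) polyLeftD P.toPoly Q.toPoly R.toPoly

theorem mul_add_aux (P Q R : DiffOp K) : P * (Q + R) = P * Q + P * R :=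
  map_add (polyAct (V := Polynomial K) polyLeftD P.toPoly) Q.toPoly R.toPoly

theorem zero_mul_aux (P : DiffOp K) : 0 * P = 0 :=
  polyAct_zero (K := K) (V := Polynomial K) polyLeftD P.toPoly

theorem mul_zero_aux (P : DiffOp K) : P * 0 = 0 :=
  map_zero (polyAct (V := Polynomial K) polyLeftD P.toPoly)

theorem mul_one_aux (P : DiffOp K) : P * 1 = P := polyAct_polyLeftD_one P.toPoly

noncomputable instance : Ring (DiffOp K) :=
  { (inferInstance : AddCommGroup (DiffOp K)), (inferInstance : One (DiffOp K)),
    (inferInstance : Mul (DiffOp K)) with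
    left_distrib := mul_add_aux
    right_distrib := add_mul_aux
    zero_mul := zero_mul_aux
    mul_zero := mul_zero_aux
    mul_assoc := mul_assoc_aux
    one_mul := one_mul_aux
    mul_one := mul_one_aux }

/-- The commutation rule of `K[D]`. -/
theorem D_mul_const (a : K) : (D * const a : DiffOp K) = const a * D + const a′ := by
  have h1 : polyAct polyLeftD (Polynomial.X : Polynomial K) (Polynomial.C a) =
      Polynomial.C a * Polynomial.X + Polynomial.C a′ := by
    rw [← Polynomial.monomial_one_one_eq_X, ← Polynomial.monomial_zero_left (a := a),
      polyAct_monomial,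
      Function.iterate_one, polyLeftD_monomial, one_smul, Polynomial.monomial_mul_monomial,
      add_comm, Polynomial.monomial_zero_left]
    simp
  have h2 : polyAct polyLeftD (Polynomial.C a) (Polynomial.X : Polynomial K) =
      Polynomial.C a * Polynomial.X := by
    rw [← Polynomial.monomial_zero_left (a := a), polyAct_monomial, Function.iterate_zero_apply,
      Polynomial.smul_eq_C_mul, Polynomial.monomial_zero_left]
  exact h1.trans (congrArg (fun Q : Polynomial K => Q + Polynomial.C a′) h2.symm)

/-- A differential field over `K` is a left module over `K[D]`. -/
theorem mul_apply {F : Type*} [Field F] [Differential F] [Algebra K F] [DifferentialAlgebra K F]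
    (P Q : DiffOp K) (f : F) : (P * Q).apply f = P.apply (Q.apply f) := by
  refine polyAct_mul (Differential.deriv (R := F)).toLinearMap.toAddMonoidHom ?_ P.toPoly Q.toPoly f
  intro a v
  change (Differential.deriv (a • v) : F) = a′ • v + a • Differential.deriv v
  rw [Algebra.smul_def, Algebra.smul_def, Algebra.smul_def, Derivation.leibniz,
    deriv_algebraMap, smul_eq_mul, smul_eq_mul]
  ring

/-! ### Common left multiples, symmetric products, the module `K[D]/⟨L⟩` -/

/-- `N = lclm(L, M)`: the monic operator of lowest order having `L` and `M` as right factors. -/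
def IsLclm (L M N : DiffOp K) : Prop :=
  N.IsMonic ∧ (∃ A, N = A * L) ∧ (∃ B, N = B * M) ∧
    ∀ N' : DiffOp K, N' ≠ 0 → (∃ A, N' = A * L) → (∃ B, N' = B * M) → N.order ≤ N'.order

/-- `N` annihilates every product `f g` of a solution `f` of `L` and a solution `g` of `M`, in
whatever differential field extension of `K` these solutions lie. -/
def AnnihilatesProducts (L M N : DiffOp K) : Prop :=
  ∀ (F : Type u) [Field F] [Differential F] [Algebra K F] [DifferentialAlgebra K F] (f g : F),
    L.apply f = 0 → M.apply g = 0 → N.apply (f * g) = 0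

/-- `N = L ⊗ M`: the monic operator of lowest order annihilating all products of a solution of `L`
and a solution of `M`. -/
def IsSymProd (L M N : DiffOp K) : Prop :=
  N.IsMonic ∧ AnnihilatesProducts L M N ∧
    ∀ N' : DiffOp K, N' ≠ 0 → AnnihilatesProducts L M N' → N.order ≤ N'.order

/-- `IsSymPower L s N` means `N = L^{⊗ s} = L ⊗ ⋯ ⊗ L` with `s ≥ 1` factors. -/
inductive IsSymPower (L : DiffOp K) : ℕ → DiffOp K → Prop
  | one : IsSymPower L 1 L
  | succ {n : ℕ} {N N' : DiffOp K} :
      IsSymPower L n N → IsSymProd N L N' → IsSymPower L (n + 1) N'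

/-- The module `K[D]/⟨L⟩`, where `⟨L⟩` is the left ideal `{P L | P ∈ K[D]}`. -/
abbrev QuotModule (L : DiffOp K) : Type u := DiffOp K ⧸ Ideal.span {L}

/-- The class `[P]_L` in `K[D]/⟨L⟩`. -/
noncomputable def toQuot (L P : DiffOp K) : QuotModule L := Submodule.Quotient.mk P

end DiffOp

/-- A differential ring from an additive map satisfying the Leibniz rule. -/
@[reducible]
def Differential.ofLeibniz {R : Type*} [CommRing R] (d : R → R)
    (h_sum : ∀ f g, d (f + g) = d f + d g) (h_prod : ∀ f g, d (f * g) = f * d g + g * d f) :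
    Differential R where
  deriv := Derivation.mk' (AddMonoidHom.mk' d h_sum).toIntLinearMap h_prod

/-! ### The differential field `C(x)` -/

section RatFunc

variable {C : Type u} [Field C]

local notation "ι" => algebraMap (Polynomial C) (RatFunc C)

/-- The derivative of a rational function by the quotient rule. -/
noncomputable def ratDeriv (f : RatFunc C) : RatFunc C :=
  (ι f.num.derivative * ι f.denom - ι f.num * ι f.denom.derivative) / ι f.denom ^ 2

theorem ratDeriv_div (p q : Polynomial C) (hq : q ≠ 0) :
    ratDeriv (ι p / ι q) = (ι p.derivative * ι q - ι p * ι q.derivative) / ι q ^ 2 := by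
  set f := ι p / ι q with hf
  have hd : ι f.denom ≠ 0 := RatFunc.algebraMap_ne_zero f.denom_ne_zero
  have hq' : ι q ≠ 0 := RatFunc.algebraMap_ne_zero hq
  have h : f.num * q = p * f.denom := (RatFunc.num_mul_eq_mul_denom_iff hq).2 hf
  have h' := congrArg Polynomial.derivative h
  rw [Polynomial.derivative_mul, Polynomial.derivative_mul] at h'
  replace h := congrArg ι h
  replace h' := congrArg ι h'
  simp only [map_mul, map_add] at h h'
  rw [ratDeriv, div_eq_div_iff (pow_ne_zero 2 hd) (pow_ne_zero 2 hq')]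
  linear_combination (ι q * ι f.denom) * h' -
    (ι q.derivative * ι f.denom + ι f.denom.derivative * ι q) * h

theorem exists_eq_div (f : RatFunc C) : ∃ p q : Polynomial C, q ≠ 0 ∧ f = ι p / ι q :=
  ⟨f.num, f.denom, f.denom_ne_zero, f.num_div_denom.symm⟩

/-- `C(x)` with the usual derivation `d/dx`. -/
noncomputable instance : Differential (RatFunc C) :=
  Differential.ofLeibniz ratDeriv
    (by
      intro f g
      obtain ⟨p, q, hq, rfl⟩ := exists_eq_div f
      obtain ⟨a, b, hb, rfl⟩ := exists_eq_div g
      have hq' : ι q ≠ 0 := RatFunc.algebraMap_ne_zero hq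
      have hb' : ι b ≠ 0 := RatFunc.algebraMap_ne_zero hb
      have : ι p / ι q + ι a / ι b = ι (p * b + q * a) / ι (q * b) := by
        simp only [map_mul, map_add]; field_simp
      rw [this, ratDeriv_div _ _ (mul_ne_zero hq hb), ratDeriv_div _ _ hq, ratDeriv_div _ _ hb]
      simp only [Polynomial.derivative_mul, map_mul, map_add]
      field_simp
      ring)
    (by
      intro f g
      obtain ⟨p, q, hq, rfl⟩ := exists_eq_div f
      obtain ⟨a, b, hb, rfl⟩ := exists_eq_div g
      have hq' : ι q ≠ 0 := RatFunc.algebraMap_ne_zero hq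
      have hb' : ι b ≠ 0 := RatFunc.algebraMap_ne_zero hb
      have : ι p / ι q * (ι a / ι b) = ι (p * a) / ι (q * b) := by
        simp only [map_mul]; field_simp
      rw [this, ratDeriv_div _ _ (mul_ne_zero hq hb), ratDeriv_div _ _ hq, ratDeriv_div _ _ hb]
      simp only [Polynomial.derivative_mul, map_mul, map_add]
      field_simp
      ring)

theorem ratFunc_deriv (f : RatFunc C) : f′ = ratDeriv f := rfl

theorem ratFunc_deriv_algebraMap (p : Polynomial C) : (ι p)′ = ι p.derivative := by
  rw [ratFunc_deriv]
  have := ratDeriv_div p 1 one_ne_zero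
  simpa using this

end RatFunc

/-! ### Puiseux series at the points of `C ∪ {∞}` -/

section Puiseux

open HahnSeries

variable {C : Type u} [Field C]

/-- The operator `t d/dt`, multiplying the coefficient of `t^a` by `a`. -/
noncomputable def euler [CharZero C] (f : HahnSeries ℚ C) : HahnSeries ℚ C where
  coeff a := (a : C) * f.coeff a
  isPWO_support' := f.isPWO_support.mono fun a ha h => ha (by simp [h])

variable [CharZero C]

theorem coeff_euler (f : HahnSeries ℚ C) (a : ℚ) : (euler f).coeff a = (a : C) * f.coeff a := rfl

theorem euler_add (f g : HahnSeries ℚ C) : euler (f + g) = euler f + euler g := by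
  ext a; rw [coeff_euler, coeff_add, coeff_add, mul_add, coeff_euler, coeff_euler]

theorem euler_mul (f g : HahnSeries ℚ C) : euler (f * g) = f * euler g + g * euler f := by
  have hs (f : HahnSeries ℚ C) : (euler f).support ⊆ f.support := fun a ha h =>
    ha (by rw [coeff_euler, h, mul_zero])
  ext a
  rw [mul_comm g, coeff_add, coeff_mul_left' f.isPWO_support (hs f),
    coeff_mul_right' g.isPWO_support (hs g), coeff_euler, coeff_mul, Finset.mul_sum,
    ← Finset.sum_add_distrib]
  refine Finset.sum_congr rfl fun ij hij => ?_
  rw [coeff_euler, coeff_euler, ← (Finset.mem_antidiagonal.1 hij).2.2]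
  push_cast
  ring

theorem euler_single (a : ℚ) (c : C) : euler (single a c) = single a ((a : C) * c) := by
  ext b
  rw [coeff_euler]
  by_cases h : b = a
  · subst h; simp
  · simp [coeff_single_of_ne h]

/-- The field of series in the local parameter `t` of the point `ξ`, where `t = x - ξ` if `ξ ∈ C`
and `t = 1/x` if `ξ = ∞`, with rational exponents and coefficients in `C`.  Among them,
`IsPuiseux` below singles out the Puiseux series at `ξ`. -/
def SeriesAt (_ξ : OnePoint C) : Type u := HahnSeries ℚ C

variable (ξ : OnePoint C)

noncomputable instance : Field (SeriesAt ξ) := inferInstanceAs (Field (HahnSeries ℚ C))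

noncomputable instance : Algebra C (SeriesAt ξ) := (HahnSeries.instAlgebra : Algebra C (HahnSeries ℚ C))

/-- The series as a series in the local parameter. -/
def SeriesAt.toHahn {ξ : OnePoint C} (f : SeriesAt ξ) : HahnSeries ℚ C := f

/-- A series in the local parameter. -/
def SeriesAt.ofHahn (f : HahnSeries ℚ C) : SeriesAt ξ := f

/-- The local parameter `t`. -/
noncomputable def localParam : SeriesAt ξ := SeriesAt.ofHahn ξ (single 1 1)

/-- The expansion of `x` at the point `ξ`: it is `ξ + t` at `ξ ∈ C` and `t⁻¹` at `∞`. -/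
noncomputable def xAt : SeriesAt ξ :=
  ξ.elim (localParam ξ)⁻¹ fun c => algebraMap C (SeriesAt ξ) c + localParam ξ

/-- The factor `u` such that `d/dx = u · t d/dt`: it is `t⁻¹` at `ξ ∈ C` and `-t` at `∞`. -/
noncomputable def eulerFactor : SeriesAt ξ :=
  ξ.elim (-localParam ξ) fun _ => (localParam ξ)⁻¹

/-- The derivation `d/dx`: it is `d/dt` at `ξ ∈ C` and `-t² d/dt` at `∞`. -/
noncomputable instance : Differential (SeriesAt ξ) :=
  Differential.ofLeibniz (fun f => eulerFactor ξ * SeriesAt.ofHahn ξ (euler f.toHahn))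
    (fun f g => by
      rw [← mul_add]; exact congrArg (eulerFactor ξ * ·) (euler_add f.toHahn g.toHahn))
    (fun f g => by
      have h : SeriesAt.ofHahn ξ (euler (f * g).toHahn) = f * SeriesAt.ofHahn ξ (euler g.toHahn) +
        g * SeriesAt.ofHahn ξ (euler f.toHahn) := euler_mul f.toHahn g.toHahn
      rw [h]; ring)

theorem seriesAt_deriv (f : SeriesAt ξ) :
    f′ = eulerFactor ξ * SeriesAt.ofHahn ξ (euler f.toHahn) := rfl

theorem deriv_algebraMap_seriesAt (c : C) : (algebraMap C (SeriesAt ξ) c)′ = 0 := by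
  have h : (algebraMap C (SeriesAt ξ) c).toHahn = single 0 c := rfl
  rw [seriesAt_deriv, h, euler_single, Rat.cast_zero, zero_mul, map_zero]
  exact mul_zero _

theorem localParam_ne_zero : localParam ξ ≠ 0 :=
  HahnSeries.single_ne_zero (Γ := ℚ) (a := 1) (one_ne_zero (α := C))

theorem localParam_deriv : (localParam ξ)′ = eulerFactor ξ * localParam ξ := by
  have h : euler (single (1 : ℚ) (1 : C)) = single 1 1 := by rw [euler_single]; simp
  rw [seriesAt_deriv]
  exact congrArg (eulerFactor ξ * SeriesAt.ofHahn ξ ·) h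

theorem xAt_deriv : (xAt ξ)′ = 1 := by
  have ht := localParam_ne_zero ξ
  induction ξ using OnePoint.rec with
  | infty =>
    have h : localParam (OnePoint.infty : OnePoint C) * xAt OnePoint.infty = 1 :=
      mul_inv_cancel₀ ht
    have h' := congrArg (fun f => f′) h
    simp only [Derivation.leibniz, localParam_deriv, Derivation.map_one_eq_zero, smul_eq_mul] at h'
    have hu : eulerFactor (OnePoint.infty : OnePoint C) = -localParam _ := rfl
    rw [hu] at h'
    refine mul_left_cancel₀ ht ?_
    linear_combination h' + localParam _ * h
  | coe c =>
    have hx : xAt (c : OnePoint C) = algebraMap C _ c + localParam _ := rfl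
    have hu : eulerFactor (c : OnePoint C) = (localParam _)⁻¹ := rfl
    rw [hx, map_add, deriv_algebraMap_seriesAt, localParam_deriv, hu, zero_add,
      inv_mul_cancel₀ ht]

theorem deriv_aeval_xAt (p : Polynomial C) :
    (Polynomial.aeval (xAt ξ) p)′ = Polynomial.aeval (xAt ξ) p.derivative := by
  induction p using Polynomial.induction_on' with
  | add p q h1 h2 => simp only [map_add, h1, h2]
  | monomial n c =>
    rw [Polynomial.derivative_monomial, Polynomial.aeval_monomial, Polynomial.aeval_monomial,
      Derivation.leibniz, deriv_algebraMap_seriesAt, Derivation.leibniz_pow, xAt_deriv]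
    simp only [smul_eq_mul, nsmul_eq_mul, map_mul, map_natCast]
    ring

theorem localParam_pow (n : ℕ) :
    localParam ξ ^ n = SeriesAt.ofHahn ξ (single (n : ℚ) (1 : C)) := by
  have : (single (1 : ℚ) (1 : C)) ^ n = single (n : ℚ) 1 := by
    rw [HahnSeries.single_pow]; simp
  exact this

theorem aeval_localParam_injective (p : Polynomial C)
    (hp : Polynomial.aeval (localParam ξ) p = 0) : p = 0 := by
  have key : ∀ (p : Polynomial C) (a : ℕ),
      (Polynomial.aeval (localParam ξ) p).toHahn.coeff (a : ℚ) = p.coeff a := by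
    intro p a
    induction p using Polynomial.induction_on' with
    | add p q h1 h2 =>
      rw [map_add, Polynomial.coeff_add, ← h1, ← h2]; rfl
    | monomial n c =>
      rw [Polynomial.aeval_monomial, localParam_pow]
      have : (algebraMap C (SeriesAt ξ) c * SeriesAt.ofHahn ξ (single (n : ℚ) (1 : C))).toHahn =
          (single (0 : ℚ) c) * single (n : ℚ) (1 : C) := rfl
      rw [this, single_mul_single, zero_add, mul_one, coeff_single, Polynomial.coeff_monomial]
      simp [eq_comm]
  ext a
  rw [← key, hp]; rfl

theorem aeval_xAt_injective (p : Polynomial C) (hp : Polynomial.aeval (xAt ξ) p = 0) : p = 0 := by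
  induction ξ using OnePoint.rec with
  | infty =>
    have hx : xAt (OnePoint.infty : OnePoint C) = (localParam _)⁻¹ := rfl
    let : Invertible (xAt (OnePoint.infty : OnePoint C)) :=
      invertibleOfNonzero (hx ▸ inv_ne_zero (localParam_ne_zero _))
    have h := (Polynomial.eval₂_reverse_eq_zero_iff
      (algebraMap C (SeriesAt (OnePoint.infty : OnePoint C))) (xAt OnePoint.infty) p).2 hp
    rw [invOf_eq_inv, hx, inv_inv] at h
    exact Polynomial.reverse_eq_zero.1 (aeval_localParam_injective _ _ h)
  | coe c =>
    have hx : xAt (c : OnePoint C) = algebraMap C _ c + localParam _ := rfl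
    have h : Polynomial.aeval (localParam (c : OnePoint C)) (p.comp (Polynomial.X + Polynomial.C c)) = 0 := by
      rw [Polynomial.aeval_comp, ← hp, hx]
      simp [add_comm]
    have h' := congrArg (Polynomial.comp · (Polynomial.X - Polynomial.C c))
      (aeval_localParam_injective _ _ h)
    simpa [Polynomial.comp_assoc] using h'

/-- The expansion of a rational function at `ξ`. -/
noncomputable def expand : RatFunc C →+* SeriesAt ξ :=
  RatFunc.liftRingHom (Polynomial.aeval (xAt ξ) : Polynomial C →ₐ[C] SeriesAt ξ).toRingHom
    fun p hp => mem_nonZeroDivisors_of_ne_zero fun h =>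
      nonZeroDivisors.ne_zero hp (aeval_xAt_injective ξ p h)

noncomputable instance : Algebra (RatFunc C) (SeriesAt ξ) := (expand ξ).toAlgebra

theorem algebraMap_seriesAt_div (p q : Polynomial C) :
    algebraMap (RatFunc C) (SeriesAt ξ)
      (algebraMap (Polynomial C) (RatFunc C) p / algebraMap (Polynomial C) (RatFunc C) q) =
    Polynomial.aeval (xAt ξ) p / Polynomial.aeval (xAt ξ) q :=
  RatFunc.liftRingHom_apply_div _ _ p q

theorem algebraMap_seriesAt_X : algebraMap (RatFunc C) (SeriesAt ξ) RatFunc.X = xAt ξ := by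
  have := algebraMap_seriesAt_div ξ Polynomial.X 1
  simpa using this

instance : DifferentialAlgebra (RatFunc C) (SeriesAt ξ) where
  deriv_algebraMap f := by
    obtain ⟨p, q, hq, rfl⟩ := exists_eq_div f
    have hq' : Polynomial.aeval (xAt ξ) q ≠ 0 := fun h => hq (aeval_xAt_injective ξ q h)
    rw [ratFunc_deriv, ratDeriv_div _ _ hq, ← map_mul, ← map_mul, ← map_sub, ← map_pow,
      algebraMap_seriesAt_div, algebraMap_seriesAt_div, Derivation.leibniz_div, deriv_aeval_xAt,
      deriv_aeval_xAt]
    simp only [smul_eq_mul, map_mul, map_sub, map_pow]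
    field_simp

variable {ξ}

/-- Puiseux series: the exponents have a common denominator. -/
def SeriesAt.IsPuiseux (f : SeriesAt ξ) : Prop :=
  ∃ q : ℕ, 0 < q ∧ ∀ a : ℚ, f.toHahn.coeff a ≠ 0 → ∃ n : ℤ, a = n / q

/-- A series is integral if its starting exponent is nonnegative (or if it is zero). -/
def SeriesAt.IsIntegral (f : SeriesAt ξ) : Prop :=
  ∀ a : ℚ, f.toHahn.coeff a ≠ 0 → 0 ≤ a

end Puiseux

/-! ### Pseudoconstants -/

namespace DiffOp

variable {C : Type u} [Field C] [CharZero C]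

/-- `L` has a basis of Puiseux series solutions at `ξ`: there are `ord(L)` many such solutions
which are linearly independent over `C`. -/
def HasPuiseuxBasis (L : DiffOp (RatFunc C)) (ξ : OnePoint C) : Prop :=
  ∃ v : Fin L.order → SeriesAt ξ,
    LinearIndependent C v ∧ ∀ i, (v i).IsPuiseux ∧ L.apply (v i) = 0

/-- `L` has only rational solutions: its solution space in `K = C(x)` has dimension `ord(L)`, that
is, there are `ord(L)` many rational solutions which are linearly independent over `C`. -/
def HasOnlyRationalSolutions (L : DiffOp (RatFunc C)) : Prop :=
  ∃ v : Fin L.order → RatFunc C, LinearIndependent C v ∧ ∀ i, L.apply (v i) = 0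

/-- `[P]_L` is completely integral: at every point `ξ` of `C ∪ {∞}` and for every Puiseux series
solution `f` of `L` at `ξ`, the series `P · f` is integral. -/
def IsCompletelyIntegral (L P : DiffOp (RatFunc C)) : Prop :=
  ∀ (ξ : OnePoint C) (f : SeriesAt ξ), f.IsPuiseux → L.apply f = 0 → (P.apply f).IsIntegral

/-- `[P]_L` is a constant: `D · [P]_L = 0` in `K[D]/⟨L⟩`. -/
def IsConstant (L P : DiffOp (RatFunc C)) : Prop := (D : DiffOp (RatFunc C)) • toQuot L P = 0

/-- `[P]_L` is a pseudoconstant: it is completely integral but not a constant. -/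
def IsPseudoconstant (L P : DiffOp (RatFunc C)) : Prop :=
  IsCompletelyIntegral L P ∧ ¬ IsConstant L P

/-- `L` has a pseudoconstant, that is, `K[D]/⟨L⟩` contains one. -/
def HasPseudoconstant (L : DiffOp (RatFunc C)) : Prop := ∃ P, IsPseudoconstant L P

end DiffOp

/-! Let `N` be the lclm of `L` and `M`, let `Ns` be its `s`-th symmetric power, let `[P]` be
completely integral for `Ns`, and suppose that no symmetric power of `L` with at most `s` factors
has a pseudoconstant. The claim is that `[P]` is a constant, that is, that `Ns` divides `D * P` on
the right.

Divisibility is tested on solutions at one point. The solutions of `N` come from those of `L` and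
the rational solutions of `M`, so it is enough that `D * P` kills every product of `s` factors of
these two kinds. Such a product is `g * f`, where `g` is rational and `f` is a product of `d`
solutions of `L`.

If `d = 0`, then `P · g` is a rational function that is integral at every point of the projective
line. It has no poles, hence is a constant, and `D` kills it
(`RatFunc.deriv_eq_zero_of_isIntegral`).

If `d > 0`, then `Ns * const g` kills all products of `d` solutions of `L`, so it is a left multiple
of the `d`-th symmetric power of `L`. Multiplication by `g` thus sends Puiseux solutions of that
power to Puiseux solutions of `Ns`, and `[P * const g]` is completely integral for it
(`IsCompletelyIntegral.mul_const`). By assumption this class is a constant, so `D * P * const g`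
kills `f`.

The divisibility test rests on a Wronskian argument (`LinearIndependent.determinesOperators`), on
the order bound for the lclm (`IsLclm.determinesOperators`), and on `IsSymPower.exists_eq_mul`,
which passes from products in one field of series to products in all differential extensions, as the
definition of the symmetric product demands. -/

namespace DiffOp

open Polynomial

/-! ### Leading coefficients and right division in `K[D]` -/

section Ring

variable {K : Type u} [Field K] [Differential K]

@[ext]
theorem ext_coeff {P Q : DiffOp K} (h : ∀ i, P.toPoly.coeff i = Q.toPoly.coeff i) : P = Q :=
  Polynomial.ext h

theorem toPoly_zero : (0 : DiffOp K).toPoly = 0 := rfl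

theorem toPoly_const_mul (a : K) (Q : DiffOp K) : (const a * Q).toPoly = a • Q.toPoly := by
  change polyAct polyLeftD (Polynomial.C a) Q.toPoly = _
  rw [← Polynomial.monomial_zero_left, polyAct_monomial, Function.iterate_zero_apply]

theorem toPoly_D_mul (Q : DiffOp K) : (D * Q).toPoly = polyLeftD Q.toPoly := by
  change polyAct polyLeftD (Polynomial.X : K[X]) Q.toPoly = _
  rw [← Polynomial.monomial_one_one_eq_X, polyAct_monomial, one_smul, Function.iterate_one]

theorem toPoly_D_pow (n : ℕ) : ((D : DiffOp K) ^ n).toPoly = monomial n 1 := by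
  induction n with
  | zero => rfl
  | succ n ih =>
    rw [pow_succ', toPoly_D_mul, ih, polyLeftD_monomial]
    simp

theorem ofPoly_monomial (n : ℕ) (a : K) : ofPoly (monomial n a) = const a * D ^ n := by
  have h : (const a * D ^ n : DiffOp K).toPoly = monomial n a := by
    rw [toPoly_const_mul, toPoly_D_pow, smul_monomial, smul_eq_mul, mul_one]
  exact h.symm

/-- Induction on operators along the generators of `K[D]`. -/
theorem induction_left {p : DiffOp K → Prop} (one : p 1)
    (add : ∀ P Q, p P → p Q → p (P + Q)) (const_mul : ∀ a P, p P → p (const a * P))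
    (D_mul : ∀ P, p P → p (D * P)) (P : DiffOp K) : p P := by
  have hpow (n : ℕ) : p (D ^ n) := by
    induction n with
    | zero => exact one
    | succ n ih => rw [pow_succ']; exact D_mul _ ih
  change p (ofPoly P.toPoly)
  induction P.toPoly using Polynomial.induction_on' with
  | add P Q hP hQ => exact add _ _ hP hQ
  | monomial n a => rw [ofPoly_monomial]; exact const_mul _ _ (hpow n)

theorem coeff_D_mul_of_natDegree_le {Q : DiffOp K} {n : ℕ} (h : Q.order ≤ n) :
    (D * Q).order ≤ n + 1 ∧ (D * Q).toPoly.coeff (n + 1) = Q.toPoly.coeff n := by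
  have hn : Q.toPoly.natDegree ≤ n := h
  have hc (i : ℕ) : (D * Q).toPoly.coeff (i + 1) = (Q.toPoly.coeff (i + 1))′ + Q.toPoly.coeff i := by
    rw [toPoly_D_mul, polyLeftD_apply, Polynomial.coeff_add, Polynomial.coeff_X_mul,
      Differential.coeff_mapCoeffs]
  refine ⟨Polynomial.natDegree_le_iff_coeff_eq_zero.2 fun i hi => ?_, ?_⟩
  · obtain ⟨i, rfl⟩ : ∃ j, i = j + 1 := ⟨i - 1, by omega⟩
    rw [hc, Polynomial.coeff_eq_zero_of_natDegree_lt (by omega),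
      Polynomial.coeff_eq_zero_of_natDegree_lt (by omega)]
    simp
  · rw [hc, Polynomial.coeff_eq_zero_of_natDegree_lt (by omega)]
    simp

theorem coeff_D_pow_mul {Q : DiffOp K} {n : ℕ} (h : Q.order ≤ n) (k : ℕ) :
    (D ^ k * Q).order ≤ n + k ∧ (D ^ k * Q).toPoly.coeff (n + k) = Q.toPoly.coeff n := by
  induction k with
  | zero => simpa using h
  | succ k ih =>
    rw [pow_succ', mul_assoc, ← add_assoc]
    obtain ⟨h1, h2⟩ := coeff_D_mul_of_natDegree_le ih.1
    exact ⟨h1, h2.trans ih.2⟩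

/-- Moving `D` past a coefficient only creates terms of lower order, so top coefficients multiply as
for commutative polynomials. -/
theorem coeff_mul_of_order_le {P Q : DiffOp K} {m n : ℕ} (hP : P.order ≤ m) (hQ : Q.order ≤ n) :
    (P * Q).order ≤ m + n ∧
      (P * Q).toPoly.coeff (m + n) = P.toPoly.coeff m * Q.toPoly.coeff n := by
  have hsum : (P * Q).toPoly =
      ∑ i ∈ Finset.range (m + 1), P.toPoly.coeff i • (D ^ i * Q).toPoly := by
    change polyAct polyLeftD P.toPoly Q.toPoly = _
    rw [polyAct_apply, Polynomial.sum_over_range' _ (by simp) (m + 1) (Nat.lt_succ_of_le hP)]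
    refine Finset.sum_congr rfl fun i _ => congrArg _ ?_
    clear * -
    induction i with
    | zero => simp
    | succ i ih => rw [Function.iterate_succ_apply', ih, pow_succ', mul_assoc, toPoly_D_mul]
  have hlt (i j : ℕ) (h : i + n < j) : (D ^ i * Q).toPoly.coeff j = 0 :=
    Polynomial.coeff_eq_zero_of_natDegree_lt
      (lt_of_le_of_lt (coeff_D_pow_mul hQ i).1 (by omega))
  constructor
  · refine Polynomial.natDegree_le_iff_coeff_eq_zero.2 fun j hj => ?_
    rw [hsum, Polynomial.finsetSum_coeff]
    refine Finset.sum_eq_zero fun i hi => ?_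
    rw [Finset.mem_range] at hi
    rw [Polynomial.coeff_smul, hlt i j (by omega), smul_zero]
  · rw [hsum, Polynomial.finsetSum_coeff, Finset.sum_range_succ, Finset.sum_eq_zero,
      Polynomial.coeff_smul, add_comm m n, (coeff_D_pow_mul hQ m).2, zero_add, smul_eq_mul]
    intro i hi
    rw [Finset.mem_range] at hi
    rw [Polynomial.coeff_smul, hlt i _ (by omega), smul_zero]

theorem leadingCoeff_ne_zero {P : DiffOp K} (hP : P ≠ 0) : P.toPoly.coeff P.order ≠ 0 :=
  Polynomial.leadingCoeff_ne_zero.2 hP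

theorem mul_ne_zero_of_ne_zero {P Q : DiffOp K} (hP : P ≠ 0) (hQ : Q ≠ 0) : P * Q ≠ 0 := by
  intro h
  have := (coeff_mul_of_order_le (le_refl P.order) (le_refl Q.order)).2
  rw [h] at this
  exact mul_ne_zero (leadingCoeff_ne_zero hP) (leadingCoeff_ne_zero hQ) this.symm

theorem IsMonic.ne_zero {P : DiffOp K} (h : P.IsMonic) : P ≠ 0 :=
  Polynomial.Monic.ne_zero h

theorem order_const_mul_le (a : K) (Q : DiffOp K) : (const a * Q).order ≤ Q.order := by
  change (const a * Q).toPoly.natDegree ≤ _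
  rw [toPoly_const_mul]
  exact Polynomial.natDegree_smul_le a Q.toPoly

/-- Division with remainder on the right by a nonzero operator. -/
theorem exists_eq_mul_add {L : DiffOp K} (hL : L ≠ 0) (Q : DiffOp K) :
    ∃ A R : DiffOp K, Q = A * L + R ∧ ∀ i, L.order ≤ i → R.toPoly.coeff i = 0 := by
  suffices H : ∀ (m : ℕ) (Q : DiffOp K), (∀ i, m ≤ i → Q.toPoly.coeff i = 0) →
      ∃ A R : DiffOp K, Q = A * L + R ∧ ∀ i, L.order ≤ i → R.toPoly.coeff i = 0 from
    H (Q.order + 1) Q fun i hi => Polynomial.coeff_eq_zero_of_natDegree_lt hi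
  intro m
  induction m with
  | zero => exact fun Q hQ => ⟨0, Q, by simp, fun i _ => hQ i i.zero_le⟩
  | succ m ih =>
    intro Q hQ
    by_cases hm : m < L.order
    · exact ⟨0, Q, by simp, fun i hi => hQ i (by omega)⟩
    obtain ⟨k, rfl⟩ : ∃ k, m = L.order + k := ⟨m - L.order, by omega⟩
    -- `T * L` has the same coefficient as `Q` in degree `L.order + k`, so subtracting it lowers the
    -- degree bound by one.
    set T : DiffOp K := const (Q.toPoly.coeff (L.order + k) / L.toPoly.coeff L.order) * D ^ k
      with hT
    obtain ⟨h1, h2⟩ := coeff_D_pow_mul (le_refl L.order) k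
    obtain ⟨A, R, hA, hR⟩ := ih (Q - T * L) fun i hi => by
      have hc : (Q - T * L).toPoly.coeff i = Q.toPoly.coeff i - (T * L).toPoly.coeff i :=
        Polynomial.coeff_sub Q.toPoly (T * L).toPoly i
      rw [hc, hT, mul_assoc, toPoly_const_mul, Polynomial.coeff_smul, smul_eq_mul]
      obtain rfl | hi := hi.eq_or_lt
      · rw [h2, div_mul_cancel₀ _ (leadingCoeff_ne_zero hL), sub_self]
      · rw [hQ i hi, Polynomial.coeff_eq_zero_of_natDegree_lt (lt_of_le_of_lt h1 hi)]
        simp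
    refine ⟨A + T, R, ?_, hR⟩
    rw [add_mul, add_right_comm, ← hA, sub_add_cancel]

theorem order_lt_of_coeff_eq_zero {R : DiffOp K} {n : ℕ} (hR : R ≠ 0)
    (h : ∀ i, n ≤ i → R.toPoly.coeff i = 0) : R.order < n := by
  by_contra! hn
  exact leadingCoeff_ne_zero hR (h _ hn)

/-- A left multiple of a nonzero operator by an element of `K` is monic. -/
theorem exists_isMonic_const_mul {Q : DiffOp K} (hQ : Q ≠ 0) :
    ∃ a : K, (const a * Q).IsMonic := by
  refine ⟨(Q.toPoly.leadingCoeff)⁻¹, ?_⟩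
  change (const _ * Q).toPoly.Monic
  rw [toPoly_const_mul, Polynomial.smul_eq_C_mul, mul_comm]
  exact Polynomial.monic_mul_leadingCoeff_inv hQ

theorem smul_toQuot_eq_zero_iff {L P Q : DiffOp K} :
    Q • toQuot L P = 0 ↔ ∃ A, Q * P = A * L := by
  rw [toQuot, ← Submodule.Quotient.mk_smul, Submodule.Quotient.mk_eq_zero, smul_eq_mul,
    Ideal.mem_span_singleton']
  simp only [eq_comm]

end Ring

/-! ### The action on differential fields -/

section Action

variable {K : Type u} [Field K]
  {F : Type*} [Field F] [Differential F] [Algebra K F]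

theorem apply_eq_sum_range (L : DiffOp K) {n : ℕ} (h : L.order < n) (f : F) :
    L.apply f = ∑ i ∈ Finset.range n, L.toPoly.coeff i • ((fun g : F => g′)^[i] f) :=
  Polynomial.sum_over_range' _ (by simp) n h

theorem apply_eq_polyAct (L : DiffOp K) (f : F) :
    L.apply f = polyAct (Differential.deriv (R := F)).toLinearMap.toAddMonoidHom L.toPoly f := rfl

theorem add_apply (P Q : DiffOp K) (f : F) : (P + Q).apply f = P.apply f + Q.apply f :=
  polyAct_add (V := F) Differential.deriv.toLinearMap.toAddMonoidHom P.toPoly Q.toPoly f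

theorem zero_apply (f : F) : (0 : DiffOp K).apply f = 0 :=
  polyAct_zero (K := K) (V := F) Differential.deriv.toLinearMap.toAddMonoidHom f

theorem apply_add (P : DiffOp K) (f g : F) : P.apply (f + g) = P.apply f + P.apply g := by
  simp only [apply_eq_polyAct, map_add]

theorem apply_zero (P : DiffOp K) : P.apply (0 : F) = 0 := by
  simp only [apply_eq_polyAct, map_zero]

theorem const_apply (a : K) (f : F) : (const a).apply f = a • f := by
  rw [apply_eq_polyAct]
  change polyAct _ (Polynomial.C a) f = _
  rw [← Polynomial.monomial_zero_left, polyAct_monomial, Function.iterate_zero_apply]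

theorem D_apply (f : F) : (D : DiffOp K).apply f = f′ := by
  rw [apply_eq_polyAct]
  change polyAct _ (Polynomial.X : K[X]) f = _
  rw [← Polynomial.monomial_one_one_eq_X, polyAct_monomial, one_smul]
  rfl

theorem sum_apply {ι : Type*} (s : Finset ι) (P : ι → DiffOp K) (f : F) :
    (∑ i ∈ s, P i).apply f = ∑ i ∈ s, (P i).apply f := by
  classical
  induction s using Finset.induction_on with
  | empty => simp [zero_apply]
  | insert i s hi ih => rw [Finset.sum_insert hi, Finset.sum_insert hi, add_apply, ih]

variable [Differential K] [DifferentialAlgebra K F]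

theorem one_apply (f : F) : (1 : DiffOp K).apply f = f := by
  rw [apply_eq_polyAct]
  change polyAct _ (1 : K[X]) f = _
  rw [← Polynomial.monomial_zero_one, polyAct_monomial, one_smul, Function.iterate_zero_apply]

theorem iterate_deriv_algebraMap (i : ℕ) (a : K) :
    (fun g : F => g′)^[i] (algebraMap K F a) = algebraMap K F ((fun g : K => g′)^[i] a) := by
  induction i with
  | zero => rfl
  | succ i ih => rw [Function.iterate_succ_apply', ih, Function.iterate_succ_apply', deriv_algebraMap]

theorem apply_algebraMap (P : DiffOp K) (a : K) :
    P.apply (algebraMap K F a) = algebraMap K F (P.apply a) := by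
  rw [apply_eq_sum_range P (Nat.lt_succ_self _), apply_eq_sum_range P (Nat.lt_succ_self _), map_sum]
  refine Finset.sum_congr rfl fun i _ => ?_
  rw [iterate_deriv_algebraMap, Algebra.smul_def, smul_eq_mul, map_mul]

theorem mul_const_apply (P : DiffOp K) (a : K) (f : F) :
    (P * const a).apply f = P.apply (algebraMap K F a * f) := by
  rw [mul_apply, const_apply, Algebra.smul_def]

end Action

end DiffOp
-- Linear independence over constants and operators of small order
section Wronskian

variable {F : Type*} [Field F] [Differential F]

/-- A nonzero subspace of `F^ι` which is stable under the derivation contains a nonzero vector of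
constants. -/
theorem Submodule.exists_deriv_eq_zero_of_stable {ι : Type*} [Fintype ι] (R : Submodule F (ι → F))
    (hR : ∀ b ∈ R, (fun i => (b i)′) ∈ R) (hne : R ≠ ⊥) :
    ∃ b ∈ R, b ≠ 0 ∧ ∀ i, (b i)′ = 0 := by
  classical
  let supp (b : ι → F) : Finset ι := Finset.univ.filter fun i => b i ≠ 0
  have hex : ∃ n, ∃ b ∈ R, b ≠ 0 ∧ (supp b).card = n := by
    obtain ⟨b, hb, h0⟩ := R.exists_mem_ne_zero_of_ne_bot hne
    exact ⟨_, b, hb, h0, rfl⟩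
  -- Take a nonzero vector of minimal support and scale one entry to `1`. Its derivative has smaller
  -- support, since that entry becomes `0`, so by minimality the derivative vanishes.
  obtain ⟨b, hb, h0, hcard⟩ := Nat.find_spec hex
  obtain ⟨i₀, hi₀⟩ := Function.ne_iff.1 h0
  rw [Pi.zero_apply] at hi₀
  have hb₁ : (b i₀)⁻¹ • b ∈ R := R.smul_mem _ hb
  refine ⟨_, hb₁, smul_ne_zero (inv_ne_zero hi₀) h0, ?_⟩
  by_contra! hd
  obtain ⟨k, hk⟩ := hd
  refine Nat.find_min hex (m := (supp fun i => (((b i₀)⁻¹ • b) i)′).card) ?_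
    ⟨_, hR _ hb₁, Function.ne_iff.2 ⟨k, hk⟩, rfl⟩
  rw [← hcard]
  refine Finset.card_lt_card (Finset.ssubset_iff_of_subset ?_ |>.2 ⟨i₀, ?_, ?_⟩)
  · intro i hi
    simp only [supp, Finset.mem_filter, Finset.mem_univ, true_and] at hi ⊢
    intro h
    simp [h] at hi
  · simpa [supp] using hi₀
  · have h1 : ((b i₀)⁻¹ • b) i₀ = 1 := by simp [hi₀]
    rw [Finset.mem_filter]
    beta_reduce
    rw [h1]
    simp

variable {C : Type*} [Field C] [Algebra C F]

/-- Elements which are linearly independent over the constants are not all annihilated by an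
operator over `F` whose order is smaller than their number. -/
theorem LinearIndependent.exists_sum_iterate_deriv_ne_zero
    (hC : ∀ b : F, b′ = 0 → ∃ c : C, algebraMap C F c = b) {ι : Type*} [Fintype ι] {v : ι → F}
    (hv : LinearIndependent C v) {m : ℕ} (hm : m < Fintype.card ι) {c : ℕ → F} (hc : c m ≠ 0) :
    ∃ i, ∑ j ∈ Finset.range (m + 1), c j * (fun g : F => g′)^[j] (v i) ≠ 0 := by
  by_contra! h
  -- The first `m` rows of the Wronskian matrix; with more columns than rows its kernel is nonzero.
  let T : (ι → F) →ₗ[F] (Fin m → F) :=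
    LinearMap.pi fun j => Fintype.linearCombination F fun i => (fun g : F => g′)^[(j : ℕ)] (v i)
  have hT (b : ι → F) : b ∈ LinearMap.ker T ↔
      ∀ j < m, ∑ i, b i * (fun g : F => g′)^[j] (v i) = 0 := by
    rw [LinearMap.mem_ker, funext_iff]
    simp [T, Fintype.linearCombination_apply, Fin.forall_iff]
  -- As `c m ≠ 0`, the assumed equation makes row `m` a combination of the rows above it.
  have hker (b : ι → F) (hb : b ∈ LinearMap.ker T) :
      ∀ j ≤ m, ∑ i, b i * (fun g : F => g′)^[j] (v i) = 0 := by
    intro j hj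
    obtain hj | rfl := hj.lt_or_eq
    · exact (hT b).1 hb j hj
    have h1 : ∑ i, b i * ∑ k ∈ Finset.range (j + 1), c k * (fun g : F => g′)^[k] (v i) = 0 :=
      Finset.sum_eq_zero fun i _ => by rw [h i, mul_zero]
    simp only [Finset.mul_sum] at h1
    rw [Finset.sum_comm, Finset.sum_range_succ, Finset.sum_eq_zero, zero_add] at h1
    · refine (mul_eq_zero.1 ?_).resolve_left hc
      rw [← h1, Finset.mul_sum]
      exact Finset.sum_congr rfl fun i _ => by ring
    · intro k hk
      rw [← mul_zero (c k), ← (hT b).1 hb k (Finset.mem_range.1 hk), Finset.mul_sum]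
      exact Finset.sum_congr rfl fun i _ => by ring
  -- The kernel is stable: differentiate the relation for row `j` and subtract the one for row `j +
  -- 1`, which by `hker` is available even for `j + 1 = m`.
  obtain ⟨b, hb, hb0, hbc⟩ := Submodule.exists_deriv_eq_zero_of_stable (LinearMap.ker T)
    (fun b hb => (hT _).2 fun j hj => by
      have h1 := congrArg (fun g : F => g′) (hker b hb j hj.le)
      have h2 := hker b hb (j + 1) hj
      simp only [map_sum, Derivation.leibniz, smul_eq_mul, Finset.sum_add_distrib, map_zero] at h1
      simp only [Function.iterate_succ_apply'] at h2
      rw [h2, zero_add] at h1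
      rw [← h1]
      exact Finset.sum_congr rfl fun i _ => mul_comm _ _)
    (LinearMap.ker_ne_bot_of_finrank_lt (by simpa using hm))
  choose e he using fun i => hC (b i) (hbc i)
  refine hb0 (funext fun i => ?_)
  -- Row `0` is now a linear relation among the `v i` with constant coefficients.
  have h0 := hker b hb 0 m.zero_le
  simp only [Function.iterate_zero_apply, ← he, ← Algebra.smul_def] at h0
  rw [← he, Fintype.linearIndependent_iff.1 hv e h0 i, map_zero, Pi.zero_apply]

/-- No nonzero operator over `F` of order less than `r` annihilates `S`. -/
def DeterminesOperators (S : Set F) (r : ℕ) : Prop :=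
  ∀ c : ℕ → F, (∀ g ∈ S, ∑ j ∈ Finset.range r, c j * (fun g : F => g′)^[j] g = 0) →
    ∀ j < r, c j = 0

/-- The previous lemma forces the top coefficient to vanish; descend on the order. -/
theorem LinearIndependent.determinesOperators
    (hC : ∀ b : F, b′ = 0 → ∃ c : C, algebraMap C F c = b) {ι : Type*} [Fintype ι] {v : ι → F}
    (hv : LinearIndependent C v) {S : Set F} (hS : ∀ i, v i ∈ S) {r : ℕ}
    (hr : r ≤ Fintype.card ι) : DeterminesOperators S r := by
  intro c hc
  induction r with
  | zero => intro j hj; omega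
  | succ m ih =>
    have hm : c m = 0 := by
      by_contra hm
      obtain ⟨i, hi⟩ := hv.exists_sum_iterate_deriv_ne_zero hC (by omega) hm
      exact hi (hc _ (hS i))
    intro j hj
    obtain hj | rfl := (Nat.lt_succ_iff.1 hj).lt_or_eq
    · refine ih (by omega) (fun g hg => ?_) j hj
      have := hc g hg
      rwa [Finset.sum_range_succ, hm, zero_mul, add_zero] at this
    · exact hm

end Wronskian

namespace DiffOp

/-! ### Divisibility tested on solutions; expansion of `Q · (h g)` -/

section Action

variable {K : Type u} [Field K] [Differential K]
  {F : Type*} [Field F] [Differential F] [Algebra K F] [DifferentialAlgebra K F]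

theorem D_pow_apply (n : ℕ) (f : F) :
    ((D : DiffOp K) ^ n).apply f = (fun g : F => g′)^[n] f := by
  induction n with
  | zero => exact one_apply f
  | succ n ih => rw [pow_succ', mul_apply, ih, D_apply, Function.iterate_succ_apply']

/-- An operator whose order is less than `r` vanishes if it annihilates `S`. -/
theorem eq_zero_of_determinesOperators {S : Set F} {r : ℕ} (hS : DeterminesOperators S r)
    {R : DiffOp K} (hR : ∀ i, r ≤ i → R.toPoly.coeff i = 0) (h : ∀ g ∈ S, R.apply g = 0) :
    R = 0 := by
  by_contra h0
  have hlt := order_lt_of_coeff_eq_zero h0 hR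
  refine leadingCoeff_ne_zero h0 ?_
  have := hS (fun j => algebraMap K F (R.toPoly.coeff j)) (fun g hg => by
    rw [← h g hg, apply_eq_sum_range R hlt]
    simp only [Algebra.smul_def]) _ hlt
  simpa using this

/-- An operator annihilating sufficiently many solutions of `L` is right divisible by `L`. -/
theorem exists_eq_mul_of_determinesOperators {L : DiffOp K} (hL : L ≠ 0) {S : Set F}
    (hS : DeterminesOperators S L.order) (hLS : ∀ g ∈ S, L.apply g = 0) {Q : DiffOp K}
    (h : ∀ g ∈ S, Q.apply g = 0) : ∃ A, Q = A * L := by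
  obtain ⟨A, R, rfl, hR⟩ := exists_eq_mul_add hL Q
  have : R = 0 := eq_zero_of_determinesOperators hS hR fun g hg => by
    have := h g hg
    rwa [add_apply, mul_apply, hLS g hg, apply_zero, zero_add] at this
  exact ⟨A, by rw [this, add_zero]⟩

/-- The `ρ j` are the coefficients of the remainder of `Q` modulo `L`. They are chosen before `F`,
so the same formula serves in every differential extension. -/
theorem exists_apply_eq_sum {L : DiffOp K} (hL : L ≠ 0) (Q : DiffOp K) :
    ∃ ρ : ℕ → K, ∀ (F : Type u) [Field F] [Differential F] [Algebra K F] [DifferentialAlgebra K F]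
      (g : F), L.apply g = 0 →
        Q.apply g = ∑ j ∈ Finset.range L.order, ρ j • (fun g : F => g′)^[j] g := by
  obtain ⟨A, R, rfl, hR⟩ := exists_eq_mul_add hL Q
  refine ⟨R.toPoly.coeff, fun F _ _ _ _ g hg => ?_⟩
  rw [add_apply, mul_apply, hg, apply_zero, zero_add]
  by_cases h0 : R = 0
  · rw [h0, zero_apply, toPoly_zero]
    simp
  · exact apply_eq_sum_range R (order_lt_of_coeff_eq_zero h0 hR) g

/-- The expansion of `Q · (h g)` in terms of the derivatives `g^(j)`, `j < ord L`, of a solution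
`g` of `L`. -/
theorem exists_apply_mul_eq_sum {L : DiffOp K} (hL : L ≠ 0) (Q : DiffOp K) :
    ∃ q : ℕ → DiffOp K, ∀ (F : Type u) [Field F] [Differential F] [Algebra K F]
      [DifferentialAlgebra K F] (h g : F), L.apply g = 0 →
        Q.apply (h * g) =
          ∑ j ∈ Finset.range L.order, (q j).apply h * (fun g : F => g′)^[j] g := by
  induction Q using induction_left with
  | one =>
    obtain ⟨ρ, hρ⟩ := exists_apply_eq_sum hL 1
    refine ⟨fun j => const (ρ j), fun F _ _ _ _ h g hg => ?_⟩
    have := hρ F g hg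
    rw [one_apply] at this
    rw [one_apply]
    nth_rw 1 [this]
    rw [Finset.mul_sum]
    refine Finset.sum_congr rfl fun j _ => ?_
    rw [const_apply, mul_smul_comm, smul_mul_assoc]
  | add P Q hP hQ =>
    obtain ⟨p, hp⟩ := hP
    obtain ⟨q, hq⟩ := hQ
    refine ⟨p + q, fun F _ _ _ _ h g hg => ?_⟩
    simp only [add_apply, hp F h g hg, hq F h g hg, Pi.add_apply, add_mul, Finset.sum_add_distrib]
  | const_mul a P hP =>
    obtain ⟨p, hp⟩ := hP
    refine ⟨fun j => const a * p j, fun F _ _ _ _ h g hg => ?_⟩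
    simp only [mul_apply, const_apply, hp F h g hg, Finset.smul_sum, smul_mul_assoc]
  | D_mul P hP =>
    obtain ⟨p, hp⟩ := hP
    choose ρ hρ using fun j : ℕ => exists_apply_eq_sum hL (D ^ (j + 1))
    -- Differentiating `p j · h` gives the first term. Differentiating `g^(j)` gives `g^(j+1)`,
    -- rewritten in the lower derivatives through `ρ j`; this matters for the last `j`, where it
    -- reaches order `ord L`.
    refine ⟨fun i => D * p i + ∑ j ∈ Finset.range L.order, const (ρ j i) * p j,
      fun F _ _ _ _ h g hg => ?_⟩
    have hstep (j : ℕ) : ((p j).apply h * (fun g : F => g′)^[j] g)′ =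
        (∑ i ∈ Finset.range L.order, (const (ρ j i) * p j).apply h * (fun g : F => g′)^[i] g) +
          (D * p j).apply h * (fun g : F => g′)^[j] g := by
      have h1 := hρ j F g hg
      rw [D_pow_apply, Function.iterate_succ_apply'] at h1
      rw [Derivation.leibniz, h1, smul_eq_mul, smul_eq_mul, mul_apply, D_apply, Finset.mul_sum,
        mul_comm ((fun g : F => g′)^[j] g)]
      simp only [mul_apply, const_apply, mul_smul_comm, smul_mul_assoc]
    rw [mul_apply, D_apply, hp F h g hg, map_sum, Finset.sum_congr rfl fun j _ => hstep j,
      Finset.sum_add_distrib, Finset.sum_comm, ← Finset.sum_add_distrib]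
    refine Finset.sum_congr rfl fun i _ => ?_
    rw [add_apply, sum_apply, add_mul, Finset.sum_mul, add_comm]

end Action

/-! ### Existence and divisibility properties of symmetric products -/

section SymProd

variable {K : Type u} [Field K] [Differential K]

theorem AnnihilatesProducts.sub_mul {L M N Q : DiffOp K} (hN : AnnihilatesProducts L M N)
    (hQ : AnnihilatesProducts L M Q) {A R : DiffOp K} (h : Q = A * N + R) :
    AnnihilatesProducts L M R := by
  intro F _ _ _ _ f g hf hg
  have := hQ F f g hf hg
  rwa [h, add_apply, mul_apply, hN F f g hf hg, apply_zero, zero_add] at this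

/-- The remainder of `Q` modulo `N` still annihilates all products, so minimality of the order of
`N` makes it zero. -/
theorem IsSymProd.exists_eq_mul {L M N Q : DiffOp K} (hN : IsSymProd L M N)
    (hQ : AnnihilatesProducts L M Q) : ∃ A, Q = A * N := by
  obtain ⟨A, R, h, hR⟩ := exists_eq_mul_add hN.1.ne_zero Q
  refine ⟨A, ?_⟩
  by_contra hne
  have h0 : R ≠ 0 := fun h0 => hne (by rw [h, h0, add_zero])
  exact absurd (hN.2.2 R h0 (hN.2.1.sub_mul hQ h)) (order_lt_of_coeff_eq_zero h0 hR).not_ge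

/-- Vectors of operators in finite number have, modulo `K[D]N`, a nontrivial linear relation as
soon as there are enough of them. -/
theorem exists_sum_const_mul_eq_mul {N : DiffOp K} (hN : N ≠ 0) (r n : ℕ)
    (hn : r * N.order < n) (q : ℕ → ℕ → DiffOp K) :
    ∃ a : Fin n → K, a ≠ 0 ∧ ∀ j < r, ∃ A, ∑ k, const (a k) * q k j = A * N := by
  choose A R hq hR using fun k j => exists_eq_mul_add hN (q k j)
  let T : (Fin n → K) →ₗ[K] (Fin r × Fin N.order → K) :=
    LinearMap.pi fun p => Fintype.linearCombination K fun k => (R k p.1).toPoly.coeff p.2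
  obtain ⟨a, ha, ha0⟩ := (LinearMap.ker T).exists_mem_ne_zero_of_ne_bot
    (LinearMap.ker_ne_bot_of_finrank_lt (by simpa using hn))
  refine ⟨a, ha0, fun j hj => ⟨∑ k, const (a k) * A k j, ?_⟩⟩
  have hcoeff (i : ℕ) : (∑ k, const (a k) * R k j).toPoly.coeff i =
      ∑ k : Fin n, a k * (R k j).toPoly.coeff i := by
    have : (∑ k, const (a k) * R k j).toPoly = ∑ k : Fin n, (const (a k) * R k j).toPoly := rfl
    rw [this, Polynomial.finsetSum_coeff]
    refine Finset.sum_congr rfl fun k _ => ?_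
    rw [toPoly_const_mul, Polynomial.coeff_smul, smul_eq_mul]
  have hzero : ∑ k, const (a k) * R k j = 0 := by
    ext i
    rw [hcoeff, toPoly_zero, Polynomial.coeff_zero]
    by_cases hi : i < N.order
    · have := congrFun (LinearMap.mem_ker.1 ha) (⟨j, hj⟩, ⟨i, hi⟩)
      simpa [T, Fintype.linearCombination_apply] using this
    · exact Finset.sum_eq_zero fun k _ => by rw [hR k j i (by omega), mul_zero]
  calc ∑ k, const (a k) * q k j = ∑ k, const (a k) * (A k j * N + R k j) :=
        Finset.sum_congr rfl fun k _ => by rw [← hq]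
    _ = (∑ k, const (a k) * A k j) * N := by
        simp only [mul_add, Finset.sum_add_distrib, hzero, add_zero, Finset.sum_mul, mul_assoc]

theorem sum_const_mul_D_pow_ne_zero {n : ℕ} {a : Fin n → K} (ha : a ≠ 0) :
    ∑ k, const (a k) * (D : DiffOp K) ^ (k : ℕ) ≠ 0 := by
  intro h
  refine ha (funext fun k => ?_)
  have h1 : (∑ k, const (a k) * (D : DiffOp K) ^ (k : ℕ)).toPoly.coeff k =
      ∑ i : Fin n, (const (a i) * (D : DiffOp K) ^ (i : ℕ)).toPoly.coeff k :=
    Polynomial.finsetSum_coeff _ _ _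
  rw [h, toPoly_zero, Polynomial.coeff_zero, Finset.sum_eq_single k] at h1
  · rw [toPoly_const_mul, toPoly_D_pow] at h1
    simpa using h1.symm
  · intro i _ hi
    rw [toPoly_const_mul, toPoly_D_pow, Polynomial.coeff_smul,
      Polynomial.coeff_monomial_of_ne _ (by simpa [Fin.ext_iff, eq_comm] using hi), smul_zero]
  · simp

/-- A dimension count: modulo the equations of `N` and `L`, the derivatives of `h g` lie in the span
of the `h^(i) g^(j)`, of which there are `ord N · ord L`, so one more power of `D` than that yields
a relation. -/
theorem exists_annihilatesProducts {L N : DiffOp K} (hL : L ≠ 0) (hN : N ≠ 0) :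
    ∃ Q : DiffOp K, Q ≠ 0 ∧ AnnihilatesProducts N L Q := by
  choose q hq using fun k : ℕ => exists_apply_mul_eq_sum hL (D ^ k)
  obtain ⟨a, ha, hA⟩ := exists_sum_const_mul_eq_mul hN L.order _ (Nat.lt_succ_self _) q
  refine ⟨_, sum_const_mul_D_pow_ne_zero ha, fun F _ _ _ _ h g hh hg => ?_⟩
  simp only [sum_apply, mul_apply, const_apply, hq _ F h g hg, Finset.smul_sum]
  rw [Finset.sum_comm]
  refine Finset.sum_eq_zero fun j hj => ?_
  obtain ⟨A, hA⟩ := hA j (Finset.mem_range.1 hj)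
  have h1 := congrArg (fun P : DiffOp K => P.apply h) hA
  simp only [sum_apply, mul_apply, const_apply, hh, apply_zero] at h1
  simp only [← smul_mul_assoc, ← Finset.sum_mul, h1, zero_mul]

theorem exists_isSymProd {L N : DiffOp K} (hL : L ≠ 0) (hN : N ≠ 0) :
    ∃ N', IsSymProd N L N' := by
  classical
  have hex : ∃ n, ∃ Q : DiffOp K, Q ≠ 0 ∧ AnnihilatesProducts N L Q ∧ Q.order = n := by
    obtain ⟨Q, h0, hQ⟩ := exists_annihilatesProducts hL hN
    exact ⟨_, Q, h0, hQ, rfl⟩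
  obtain ⟨Q, h0, hQ, hn⟩ := Nat.find_spec hex
  obtain ⟨a, ha⟩ := exists_isMonic_const_mul h0
  refine ⟨const a * Q, ha, fun F _ _ _ _ f g hf hg => ?_, fun N' h0' hN' => ?_⟩
  · rw [mul_apply, hQ F f g hf hg, apply_zero]
  · exact (order_const_mul_le a Q).trans (hn.trans_le (Nat.find_min' hex ⟨N', h0', hN', rfl⟩))

theorem IsSymPower.ne_zero {L N : DiffOp K} (hL : L ≠ 0) {d : ℕ} (h : L.IsSymPower d N) :
    N ≠ 0 := by
  cases h with
  | one => exact hL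
  | succ _ h => exact h.1.ne_zero

theorem exists_isSymPower {L : DiffOp K} (hL : L ≠ 0) (d : ℕ) :
    ∃ N, L.IsSymPower (d + 1) N := by
  induction d with
  | zero => exact ⟨L, .one⟩
  | succ d ih =>
    obtain ⟨N, hN⟩ := ih
    obtain ⟨N', hN'⟩ := exists_isSymProd hL (hN.ne_zero hL)
    exact ⟨N', .succ hN hN'⟩

variable {F : Type u} [Field F] [Differential F] [Algebra K F] [DifferentialAlgebra K F]

/-- A symmetric power of `L` annihilates the products of solutions of `L`. -/
theorem IsSymPower.apply_prod_eq_zero {L N : DiffOp K} {d : ℕ} (h : L.IsSymPower d N)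
    (m : Multiset F) (hm : m.card = d) (hLm : ∀ f ∈ m, L.apply f = 0) : N.apply m.prod = 0 := by
  induction h generalizing m with
  | one =>
    obtain ⟨f, rfl⟩ := Multiset.card_eq_one.1 hm
    simpa using hLm
  | succ _ hN ih =>
    obtain ⟨f, hf⟩ : ∃ f, f ∈ m := Multiset.card_pos_iff_exists_mem.1 (by omega)
    obtain ⟨t, rfl⟩ := Multiset.exists_cons_of_mem hf
    rw [Multiset.prod_cons, mul_comm]
    rw [Multiset.card_cons] at hm
    exact hN.2.1 F _ _ (ih t (by omega) fun g hg => hLm g (Multiset.mem_cons_of_mem hg)) (hLm f hf)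

/-- An operator annihilating all products of `d` elements of a sufficiently large set of solutions
of `L` is right divisible by the `d`-th symmetric power of `L`. -/
theorem IsSymPower.exists_eq_mul {L N : DiffOp K} (hL : L ≠ 0) {S : Set F}
    (hS : DeterminesOperators S L.order) (hLS : ∀ g ∈ S, L.apply g = 0) {d : ℕ}
    (h : L.IsSymPower d N) {Q : DiffOp K}
    (hQ : ∀ m : Multiset F, m.card = d → (∀ f ∈ m, f ∈ S) → Q.apply m.prod = 0) :
    ∃ A, Q = A * N := by
  induction h generalizing Q with
  | one =>
    exact exists_eq_mul_of_determinesOperators hL hS hLS fun g hg => by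
      simpa using hQ {g} (by simp) (by simpa using hg)
  | succ _ hN ih =>
    refine hN.exists_eq_mul ?_
    obtain ⟨q, hq⟩ := exists_apply_mul_eq_sum hL Q
    -- Fix `m` and let `g` vary over `S`: the values `(q j).apply m.prod` are the coefficients of an
    -- operator over `F`, not over `K`, which is why `DeterminesOperators` allows coefficients in
    -- `F`.
    have hdiv : ∀ j < L.order, ∃ A, q j = A * _ := fun j hj => ih fun m hm hmS => by
      refine hS (fun j => (q j).apply m.prod) (fun g hg => ?_) j hj
      rw [← hq F _ g (hLS g hg)]
      have := hQ (g ::ₘ m) (by rw [Multiset.card_cons, hm]) (by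
        intro f hf
        obtain rfl | hf := Multiset.mem_cons.1 hf
        exacts [hg, hmS f hf])
      rwa [Multiset.prod_cons, mul_comm] at this
    -- This `F` is an arbitrary extension; divisibility of the `q j`, obtained in the given field,
    -- carries over to it.
    intro F _ _ _ _ h g hh hg
    rw [hq F h g hg]
    refine Finset.sum_eq_zero fun j hj => ?_
    obtain ⟨A, hA⟩ := hdiv j (Finset.mem_range.1 hj)
    rw [hA, mul_apply, hh, apply_zero, zero_mul]

end SymProd

end DiffOp
-- Constants, Puiseux series and integrality in the fields of series
section Series

open HahnSeries

variable {C : Type u} [Field C] [CharZero C] {ξ : OnePoint C}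

theorem eulerFactor_ne_zero (ξ : OnePoint C) : eulerFactor ξ ≠ 0 := by
  induction ξ using OnePoint.rec with
  | infty => exact neg_ne_zero.2 (localParam_ne_zero _)
  | coe c => exact inv_ne_zero (localParam_ne_zero _)

/-- The Euler operator multiplies the coefficient of `t^a` by `a`, so in characteristic zero only
the exponent `0` survives. This is the hypothesis on constants in the Wronskian argument. -/
theorem exists_algebraMap_eq_of_deriv_eq_zero (f : SeriesAt ξ) (hf : f′ = 0) :
    ∃ c : C, algebraMap C (SeriesAt ξ) c = f := by
  rw [seriesAt_deriv] at hf
  have h : euler f.toHahn = 0 := (mul_eq_zero.1 hf).resolve_left (eulerFactor_ne_zero ξ)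
  refine ⟨f.toHahn.coeff 0, ?_⟩
  change single 0 (f.toHahn.coeff 0) = f.toHahn
  ext a
  by_cases ha : a = 0
  · subst ha; simp
  · have h1 := congrArg (fun g : HahnSeries ℚ C => g.coeff a) h
    simp only [coeff_euler, coeff_zero, mul_eq_zero, Rat.cast_eq_zero] at h1
    rw [coeff_single_of_ne ha, h1.resolve_left ha]

instance : IsScalarTower C (RatFunc C) (SeriesAt ξ) :=
  IsScalarTower.of_algebraMap_eq fun c => by
    have := algebraMap_seriesAt_div ξ (Polynomial.C c) 1
    simp only [map_one, div_one, Polynomial.aeval_C] at this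
    rw [← this]
    rfl

theorem SeriesAt.IsPuiseux.mul {f g : SeriesAt ξ} (hf : f.IsPuiseux) (hg : g.IsPuiseux) :
    (f * g).IsPuiseux := by
  obtain ⟨q, hq, hf⟩ := hf
  obtain ⟨r, hr, hg⟩ := hg
  refine ⟨q * r, Nat.mul_pos hq hr, fun a ha => ?_⟩
  obtain ⟨i, hi, j, hj, rfl⟩ := Set.mem_add.1 (support_mul_subset (x := f.toHahn)
    (y := g.toHahn) (show a ∈ (f.toHahn * g.toHahn).support from ha))
  obtain ⟨m, rfl⟩ := hf i hi
  obtain ⟨n, rfl⟩ := hg j hj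
  refine ⟨m * r + n * q, ?_⟩
  have hq' : (q : ℚ) ≠ 0 := by positivity
  have hr' : (r : ℚ) ≠ 0 := by positivity
  push_cast
  field_simp

/-- The inclusion of the field of series with integral exponents. -/
noncomputable def laurentToSeriesAt (ξ : OnePoint C) : HahnSeries ℤ C →+* SeriesAt ξ :=
  embDomainRingHom (R := C) (Int.castAddHom ℚ) Int.cast_injective fun _ _ => Int.cast_le

theorem laurentToSeriesAt_single (ξ : OnePoint C) (n : ℤ) (c : C) :
    laurentToSeriesAt ξ (single n c) = SeriesAt.ofHahn ξ (single (n : ℚ) c) :=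
  embDomain_single

theorem isPuiseux_laurentToSeriesAt (f : HahnSeries ℤ C) : (laurentToSeriesAt ξ f).IsPuiseux := by
  refine ⟨1, one_pos, fun a ha => ?_⟩
  by_contra! h
  refine ha (embDomain_of_notMem_range fun ⟨n, hn⟩ => h n ?_)
  rw [← hn]
  simp

theorem aeval_xAt_mem_fieldRange (p : Polynomial C) :
    Polynomial.aeval (xAt ξ) p ∈ (laurentToSeriesAt ξ).fieldRange := by
  have hC (c : C) : algebraMap C (SeriesAt ξ) c ∈ (laurentToSeriesAt ξ).fieldRange :=
    ⟨single 0 c, by rw [laurentToSeriesAt_single, Int.cast_zero]; rfl⟩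
  have ht : localParam ξ ∈ (laurentToSeriesAt ξ).fieldRange :=
    ⟨single 1 1, by rw [laurentToSeriesAt_single, Int.cast_one]; rfl⟩
  have hx : xAt ξ ∈ (laurentToSeriesAt ξ).fieldRange := by
    induction ξ using OnePoint.rec with
    | infty => exact inv_mem ht
    | coe c => exact add_mem (hC c) ht
  rw [Polynomial.aeval_eq_sum_range]
  refine sum_mem fun i _ => ?_
  rw [Algebra.smul_def]
  exact mul_mem (hC _) (pow_mem hx i)

/-- The expansion of `x` lies in the subfield of series with integral exponents, hence so do those
of all rational functions. Complete integrality only tests Puiseux solutions, so multiplication by a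
rational function has to preserve them. -/
theorem isPuiseux_algebraMap (h : RatFunc C) :
    (algebraMap (RatFunc C) (SeriesAt ξ) h).IsPuiseux := by
  obtain ⟨p, q, -, rfl⟩ := exists_eq_div h
  rw [algebraMap_seriesAt_div]
  obtain ⟨f, hf⟩ := div_mem (aeval_xAt_mem_fieldRange (ξ := ξ) p) (aeval_xAt_mem_fieldRange q)
  rw [← hf]
  exact isPuiseux_laurentToSeriesAt f

/-- The integral series form a ring. -/
noncomputable def integralSeries (ξ : OnePoint C) : Subalgebra C (SeriesAt ξ) where
  carrier := {f | f.IsIntegral}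
  mul_mem' {f g} hf hg a ha := by
    obtain ⟨i, hi, j, hj, rfl⟩ := Set.mem_add.1 (support_mul_subset (x := f.toHahn)
      (y := g.toHahn) (show a ∈ (f.toHahn * g.toHahn).support from ha))
    exact add_nonneg (hf i hi) (hg j hj)
  add_mem' {f g} hf hg a ha := by
    by_contra h
    have h1 : f.toHahn.coeff a = 0 := by_contra fun h1 => h (hf a h1)
    have h2 : g.toHahn.coeff a = 0 := by_contra fun h2 => h (hg a h2)
    refine ha ?_
    change (f.toHahn + g.toHahn).coeff a = 0
    rw [coeff_add, h1, h2, add_zero]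
  algebraMap_mem' c a ha := by
    by_contra h
    exact ha (coeff_single_of_ne (not_le.1 h).ne)

theorem mem_integralSeries {f : SeriesAt ξ} : f ∈ integralSeries ξ ↔ f.IsIntegral := Iff.rfl

theorem localParam_mem_integralSeries : localParam ξ ∈ integralSeries ξ := by
  intro a ha
  by_contra h
  exact ha (coeff_single_of_ne ((not_le.1 h).trans one_pos).ne)

theorem eq_zero_of_algebraMap_eq_localParam_mul {c : C} {f : SeriesAt ξ}
    (hf : f ∈ integralSeries ξ) (h : algebraMap C (SeriesAt ξ) c = localParam ξ * f) : c = 0 := by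
  have h1 : (single (0 : ℚ) c : HahnSeries ℚ C) = single 1 1 * f.toHahn := h
  -- The coefficient at exponent `0` on the right is that of `f` at `-1`, which integrality
  -- excludes.
  have h2 := congrArg (fun g : HahnSeries ℚ C => g.coeff (-1 + 1)) h1
  simp only [coeff_single_mul_add, one_mul] at h2
  rw [neg_add_cancel, coeff_single_same] at h2
  rw [h2]
  by_contra h3
  have := hf (-1) h3
  norm_num at this

theorem aeval_xAt_coe_mem_integralSeries (c : C) (p : Polynomial C) :
    Polynomial.aeval (xAt (c : OnePoint C)) p ∈ integralSeries (c : OnePoint C) := by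
  rw [Polynomial.aeval_eq_sum_range]
  exact sum_mem fun i _ => Subalgebra.smul_mem _ (pow_mem (add_mem (Subalgebra.algebraMap_mem _ c)
    localParam_mem_integralSeries) i) _

theorem Polynomial.eq_C_of_aeval_xAt_infty_mem_integralSeries (p : Polynomial C)
    (hp : Polynomial.aeval (xAt (OnePoint.infty : OnePoint C)) p ∈ integralSeries OnePoint.infty) :
    p = Polynomial.C (p.coeff 0) := by
  induction hn : p.natDegree generalizing p with
  | zero => exact Polynomial.eq_C_of_natDegree_eq_zero hn
  | succ n ih =>
    have hx : localParam (OnePoint.infty : OnePoint C) * xAt OnePoint.infty = 1 :=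
      mul_inv_cancel₀ (localParam_ne_zero _)
    -- Dividing `p - p(0)` by `x` multiplies it by `t`, so `p.divX` is integral and, by induction,
    -- constant; being `t` times an integral series, that constant is zero.
    have hdiv : Polynomial.aeval (xAt (OnePoint.infty : OnePoint C)) p.divX =
        localParam OnePoint.infty * (Polynomial.aeval (xAt OnePoint.infty) p -
          algebraMap C _ (p.coeff 0)) := by
      have h := congrArg (Polynomial.aeval (xAt (OnePoint.infty : OnePoint C))) p.divX_mul_X_add
      rw [map_add, map_mul, Polynomial.aeval_X, Polynomial.aeval_C] at h
      rw [← h]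
      linear_combination -(Polynomial.aeval (xAt (OnePoint.infty : OnePoint C)) p.divX) * hx
    have hint := sub_mem hp (Subalgebra.algebraMap_mem (integralSeries OnePoint.infty) (p.coeff 0))
    have hC := ih p.divX
      (by rw [hdiv]; exact mul_mem localParam_mem_integralSeries hint)
      (by rw [Polynomial.natDegree_divX_eq_natDegree_tsub_one, hn, Nat.add_sub_cancel])
    have h0 : p.divX.coeff 0 = 0 :=
      eq_zero_of_algebraMap_eq_localParam_mul hint (by
        rw [← hdiv]
        nth_rw 2 [hC]
        rw [Polynomial.aeval_C])
    rw [h0, map_zero] at hC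
    have h := p.divX_mul_X_add
    rw [hC, zero_mul, zero_add] at h
    exact h.symm

/-- A rational function without poles on the projective line is a constant. -/
theorem RatFunc.deriv_eq_zero_of_isIntegral [IsAlgClosed C] (h : RatFunc C)
    (hint : ∀ ξ : OnePoint C, (algebraMap (RatFunc C) (SeriesAt ξ) h).IsIntegral) : h′ = 0 := by
  have hdeg : h.denom.degree = 0 := by
    by_contra hd
    obtain ⟨c, hc⟩ := IsAlgClosed.exists_root h.denom hd
    obtain ⟨q, hq⟩ := Polynomial.dvd_iff_isRoot.2 hc
    obtain ⟨p, hp⟩ := Polynomial.X_sub_C_dvd_sub_C_eval (p := h.num) (a := c)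
    have hx : Polynomial.aeval (xAt (c : OnePoint C)) (Polynomial.X - Polynomial.C c) =
        localParam (c : OnePoint C) := by
      rw [map_sub, Polynomial.aeval_X, Polynomial.aeval_C]
      exact add_sub_cancel_left _ _
    have h0 : Polynomial.aeval (xAt (c : OnePoint C)) h.denom ≠ 0 := fun h0 =>
      h.denom_ne_zero (aeval_xAt_injective _ _ h0)
    have hh := algebraMap_seriesAt_div (c : OnePoint C) h.num h.denom
    rw [h.num_div_denom, eq_div_iff h0, hq, map_mul, hx] at hh
    have hp' := congrArg (Polynomial.aeval (xAt (c : OnePoint C))) hp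
    rw [map_sub, map_mul, hx, Polynomial.aeval_C, ← hh] at hp'
    -- With denominator `(x - c) q`, integrality of `h` makes the numerator divisible by `t` at `c`.
    -- So `c` is a common root, contrary to coprimality.
    have hroot : h.num.eval c = 0 := eq_zero_of_algebraMap_eq_localParam_mul
      (sub_mem (mul_mem (mem_integralSeries.2 (hint c)) (aeval_xAt_coe_mem_integralSeries c q))
        (aeval_xAt_coe_mem_integralSeries c p)) (by linear_combination -hp')
    have hdvd := h.isCoprime_num_denom.isUnit_of_dvd' (Polynomial.dvd_iff_isRoot.2 hroot) ⟨q, hq⟩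
    exact Polynomial.not_isUnit_X_sub_C c hdvd
  have hden : h.denom = 1 :=
    Polynomial.eq_one_of_monic_natDegree_zero h.monic_denom
      (Polynomial.natDegree_eq_of_degree_eq_some hdeg)
  have hh := algebraMap_seriesAt_div (OnePoint.infty : OnePoint C) h.num h.denom
  rw [h.num_div_denom, hden, map_one, div_one] at hh
  have hnum := Polynomial.eq_C_of_aeval_xAt_infty_mem_integralSeries h.num
    (hh ▸ mem_integralSeries.2 (hint OnePoint.infty))
  rw [← h.num_div_denom, hden, map_one, div_one, ratFunc_deriv_algebraMap, hnum,
    Polynomial.derivative_C, map_zero]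

end Series

namespace DiffOp

/-! ### Solutions of `L`, of `M` and of their least common left multiple -/

section Solutions

variable {K : Type u} [Field K] [Differential K]

/-- With `n` functions there are `n` linear conditions on the `n + 1` coefficients of an operator of
order at most `n`. -/
theorem exists_order_le_and_apply_eq_zero {ι : Type*} [Fintype ι] (w : ι → K) :
    ∃ A : DiffOp K, A ≠ 0 ∧ A.order ≤ Fintype.card ι ∧ ∀ i, A.apply (w i) = 0 := by
  let T : (Fin (Fintype.card ι + 1) → K) →ₗ[K] (ι → K) :=
    LinearMap.pi fun i => Fintype.linearCombination K fun k => (fun g : K => g′)^[(k : ℕ)] (w i)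
  obtain ⟨a, ha, ha0⟩ := (LinearMap.ker T).exists_mem_ne_zero_of_ne_bot
    (LinearMap.ker_ne_bot_of_finrank_lt (by simp))
  refine ⟨_, sum_const_mul_D_pow_ne_zero ha0, ?_, fun i => ?_⟩
  · have h : (∑ k, const (a k) * D ^ (k : ℕ) : DiffOp K).toPoly =
        ∑ k, (const (a k) * D ^ (k : ℕ)).toPoly := rfl
    rw [order, h]
    refine Polynomial.natDegree_sum_le_of_forall_le _ _ fun k _ => ?_
    rw [toPoly_const_mul, toPoly_D_pow]
    exact (Polynomial.natDegree_smul_le _ _).trans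
      ((Polynomial.natDegree_monomial_le _).trans (by omega))
  · have := congrFun (LinearMap.mem_ker.1 ha) i
    simp only [sum_apply, mul_apply, const_apply, D_pow_apply]
    simpa [T, Fintype.linearCombination_apply] using this

variable {C : Type u} [Field C] [CharZero C] {ξ : OnePoint C}

theorem apply_smul_seriesAt (L : DiffOp (RatFunc C)) (c : C) (f : SeriesAt ξ) :
    L.apply (c • f) = c • L.apply f := by
  have h (i : ℕ) : (fun g : SeriesAt ξ => g′)^[i] (c • f) =
      c • (fun g : SeriesAt ξ => g′)^[i] f := by
    induction i with
    | zero => rfl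
    | succ i ih =>
      rw [Function.iterate_succ_apply', ih, Function.iterate_succ_apply', Algebra.smul_def,
        Derivation.leibniz, deriv_algebraMap_seriesAt, smul_zero, add_zero, smul_eq_mul,
        Algebra.smul_def]
  rw [apply_eq_sum_range L (Nat.lt_succ_self _), apply_eq_sum_range L (Nat.lt_succ_self _),
    Finset.smul_sum]
  exact Finset.sum_congr rfl fun i _ => by rw [h, smul_comm]

/-- The solution space of `L` among the series at `ξ`. -/
noncomputable def solutionSpace (L : DiffOp (RatFunc C)) (ξ : OnePoint C) :
    Submodule C (SeriesAt ξ) where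
  carrier := {f | L.apply f = 0}
  add_mem' {f g} hf hg := by rw [Set.mem_ofPred_eq] at *; rw [apply_add, hf, hg, add_zero]
  zero_mem' := apply_zero L
  smul_mem' c f hf := by rw [Set.mem_ofPred_eq] at *; rw [apply_smul_seriesAt, hf, smul_zero]

theorem mem_solutionSpace {L : DiffOp (RatFunc C)} {f : SeriesAt ξ} :
    f ∈ L.solutionSpace ξ ↔ L.apply f = 0 := Iff.rfl

/-- The solutions of `L` at `ξ` and the rational solutions of `M`. -/
def jointSolutions (L M : DiffOp (RatFunc C)) (ξ : OnePoint C) : Set (SeriesAt ξ) :=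
  {f | L.apply f = 0} ∪ algebraMap (RatFunc C) (SeriesAt ξ) '' {g | M.apply g = 0}

theorem HasPuiseuxBasis.determinesOperators {L : DiffOp (RatFunc C)} (hL : L.HasPuiseuxBasis ξ) :
    DeterminesOperators {f : SeriesAt ξ | L.apply f = 0} L.order := by
  obtain ⟨v, hv, hLv⟩ := hL
  exact hv.determinesOperators exists_algebraMap_eq_of_deriv_eq_zero (fun i => (hLv i).2)
    (Fintype.card_fin _).ge

/-- The solutions of `lclm(L, M)` are spanned by the solutions of `L` and `M`. -/
theorem IsLclm.determinesOperators {L M N : DiffOp (RatFunc C)} (hL : L ≠ 0) (hM : M ≠ 0)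
    (hLP : L.HasPuiseuxBasis ξ) (hMrat : M.HasOnlyRationalSolutions) (hN : IsLclm L M N) :
    DeterminesOperators (jointSolutions L M ξ) N.order := by
  classical
  obtain ⟨v, hv, hLv⟩ := hLP
  obtain ⟨u, hu, hMu⟩ := hMrat
  have hu' : LinearIndependent C fun i => algebraMap (RatFunc C) (SeriesAt ξ) (u i) :=
    hu.map' (IsScalarTower.toAlgHom C (RatFunc C) (SeriesAt ξ)).toLinearMap
      (LinearMap.ker_eq_bot.2 (algebraMap (RatFunc C) (SeriesAt ξ)).injective)
  -- Complete the basis `v` of solutions of `L` by rational solutions of `M` only.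
  obtain ⟨b, hbt, hsb, htb, hb⟩ := exists_linearIndepOn_id_extension hv.linearIndepOn_id
    (Set.subset_union_left (t := Set.range fun i => algebraMap (RatFunc C) (SeriesAt ξ) (u i)))
  have hbfin : b.Finite := ((Set.finite_range v).union (Set.finite_range _)).subset hbt
  have := hbfin.fintype
  have hw (w : ↥(b \ Set.range v)) : ∃ i, algebraMap (RatFunc C) (SeriesAt ξ) (u i) = w :=
    (hbt w.2.1).resolve_left w.2.2
  choose e he using hw
  have := (hbfin.subset (Set.sdiff_subset (t := Set.range v))).fintype
  -- `A` kills the images under `L` of the added rational solutions. So `A * L` kills all of `b`,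
  -- and its order is at most the number of added elements plus `ord L`, which is the size of `b`.
  -- Rationality keeps the coefficients of `A` in `K`.
  obtain ⟨A, hA0, hAord, hA⟩ := exists_order_le_and_apply_eq_zero fun w => L.apply (u (e w))
  have hspan : Submodule.span C b ≤ (A * L).solutionSpace ξ := by
    refine Submodule.span_le.2 fun f hf => ?_
    rw [SetLike.mem_coe, mem_solutionSpace, mul_apply]
    by_cases hfv : f ∈ Set.range v
    · obtain ⟨i, rfl⟩ := hfv
      rw [(hLv i).2, apply_zero]
    · have hef : _ = f := he ⟨f, hf, hfv⟩
      rw [← hef, apply_algebraMap, apply_algebraMap, hA, map_zero]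
  -- `A * L` kills the span of `b`, hence a full set of solutions of `M`. It is thus a common left
  -- multiple and bounds the order of `N`.
  obtain ⟨B, hB⟩ := exists_eq_mul_of_determinesOperators hM
    (hu'.determinesOperators exists_algebraMap_eq_of_deriv_eq_zero Set.mem_range_self
      (Fintype.card_fin _).ge)
    (by rintro _ ⟨i, rfl⟩; rw [apply_algebraMap, hMu, map_zero])
    (Q := A * L) fun g hg => hspan (htb (Or.inr hg))
  have hord : N.order ≤ Fintype.card b := by
    refine (hN.2.2.2 _ (mul_ne_zero_of_ne_zero hA0 hL) ⟨A, rfl⟩ ⟨B, hB⟩).trans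
      ((coeff_mul_of_order_le hAord le_rfl).1.trans ?_)
    have h1 := Set.ncard_sdiff_add_ncard_of_subset hsb hbfin
    rw [Set.ncard_eq_toFinset_card' (Set.range v), Set.toFinset_range,
      Finset.card_image_of_injective _ hv.injective, Finset.card_fin, ← Nat.card_coe_set_eq,
      ← Nat.card_coe_set_eq, Nat.card_eq_fintype_card, Nat.card_eq_fintype_card] at h1
    exact h1.le
  refine LinearIndependent.determinesOperators exists_algebraMap_eq_of_deriv_eq_zero
    (v := fun x : b => (x : SeriesAt ξ)) hb (fun x => ?_) hord
  obtain ⟨i, hi⟩ | ⟨i, hi⟩ := hbt x.2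
  · exact Or.inl (hi ▸ (hLv i).2)
  · exact Or.inr ⟨u i, hMu i, hi⟩

end Solutions

/-! ### Splitting products of solutions and transferring complete integrality -/

section Pseudoconstants

variable {C : Type u} [Field C] [CharZero C] {ξ : OnePoint C}

theorem IsLclm.apply_eq_zero {L M N : DiffOp (RatFunc C)} (hN : IsLclm L M N) {f : SeriesAt ξ}
    (hf : f ∈ jointSolutions L M ξ) : N.apply f = 0 := by
  obtain ⟨-, ⟨A, hA⟩, ⟨B, hB⟩, -⟩ := hN
  obtain hf | ⟨g, hg, rfl⟩ := hf
  · rw [hA, mul_apply, hf, apply_zero]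
  · rw [hB, mul_apply, apply_algebraMap, hg, map_zero, apply_zero]

/-- A multiset of joint solutions of `L` and `M` splits into solutions of `L` and rational
solutions of `M`. -/
theorem exists_add_map_of_jointSolutions {L M : DiffOp (RatFunc C)} (m : Multiset (SeriesAt ξ))
    (hm : ∀ f ∈ m, f ∈ jointSolutions L M ξ) :
    ∃ (m₁ : Multiset (SeriesAt ξ)) (m₂ : Multiset (RatFunc C)),
      m = m₁ + m₂.map (algebraMap (RatFunc C) (SeriesAt ξ)) ∧
        (∀ f ∈ m₁, L.apply f = 0) ∧ ∀ g ∈ m₂, M.apply g = 0 := by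
  induction m using Multiset.induction_on with
  | empty => exact ⟨0, 0, by simp⟩
  | cons f m ih =>
    obtain ⟨m₁, m₂, rfl, h₁, h₂⟩ := ih fun g hg => hm g (Multiset.mem_cons_of_mem hg)
    obtain hf | ⟨g, hg, rfl⟩ := hm f (Multiset.mem_cons_self f _)
    · exact ⟨f ::ₘ m₁, m₂, by simp, by simpa using ⟨hf, h₁⟩, h₂⟩
    · exact ⟨m₁, g ::ₘ m₂, by simp, h₁, by simpa using ⟨hg, h₂⟩⟩

/-- Multiplication by a rational solution transfers completely integral classes. -/
theorem IsCompletelyIntegral.mul_const {N N' P A : DiffOp (RatFunc C)} {g : RatFunc C}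
    (hP : IsCompletelyIntegral N P) (h : N * const g = A * N') :
    IsCompletelyIntegral N' (P * const g) := by
  intro ξ f hf hN'
  rw [mul_const_apply]
  refine hP ξ _ ((isPuiseux_algebraMap g).mul hf) ?_
  rw [← mul_const_apply, h, mul_apply, hN', apply_zero]

theorem isConstant_of_not_hasPseudoconstant {L P : DiffOp (RatFunc C)}
    (hL : ¬ L.HasPseudoconstant) (hP : IsCompletelyIntegral L P) : IsConstant L P := by
  by_contra h
  exact hL ⟨P, hP, h⟩

end Pseudoconstants

end DiffOp

/-! ### The proposition -/

open DiffOp in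
theorem mainTheorem5 {C : Type u} [Field C] [IsAlgClosed C] [CharZero C]
    (L M N : DiffOp (RatFunc C)) (hL : L ≠ 0) (hM : M ≠ 0)
    (hLP : ∀ ξ : OnePoint C, L.HasPuiseuxBasis ξ)
    (hMrat : M.HasOnlyRationalSolutions)
    (hN : DiffOp.IsLclm L M N)
    (s : ℕ) (Ns : DiffOp (RatFunc C)) (hNs : N.IsSymPower s Ns)
    (h : Ns.HasPseudoconstant) :
    ∃ d : ℕ, 1 ≤ d ∧ d ≤ s ∧
      ∃ Ld : DiffOp (RatFunc C), L.IsSymPower d Ld ∧ Ld.HasPseudoconstant := by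
  by_contra! hno
  obtain ⟨P, hP, hPc⟩ := h
  refine hPc (smul_toQuot_eq_zero_iff.2 ?_)
  have hsol (ξ : OnePoint C) (m₁ : Multiset (SeriesAt ξ)) (m₂ : Multiset (RatFunc C))
      (hcard : m₁.card + m₂.card = s) (h₁ : ∀ f ∈ m₁, L.apply f = 0)
      (h₂ : ∀ g ∈ m₂, M.apply g = 0) :
      Ns.apply (algebraMap (RatFunc C) (SeriesAt ξ) m₂.prod * m₁.prod) = 0 := by
    rw [map_multiset_prod, ← Multiset.prod_add]
    refine hNs.apply_prod_eq_zero _ (by rw [Multiset.card_add, Multiset.card_map, add_comm, hcard]) fun f hf => hN.apply_eq_zero ?_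
    obtain hf | hf := Multiset.mem_add.1 hf
    · obtain ⟨g, hg, rfl⟩ := Multiset.mem_map.1 hf
      exact Or.inr ⟨g, h₂ g hg, rfl⟩
    · exact Or.inl (h₁ f hf)
  -- Divisibility can be tested at a single point; any choice would do, and `∞` is taken.
  refine hNs.exists_eq_mul hN.1.ne_zero (hN.determinesOperators hL hM (hLP OnePoint.infty) hMrat)
    (fun f hf => hN.apply_eq_zero hf) fun m hm hmS => ?_
  obtain ⟨m₁, m₂, rfl, h₁, h₂⟩ := exists_add_map_of_jointSolutions m hmS
  rw [Multiset.card_add, Multiset.card_map] at hm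
  rw [Multiset.prod_add, ← map_multiset_prod, mul_comm, ← mul_const_apply, mul_assoc]
  obtain h0 | hpos := Nat.eq_zero_or_pos m₁.card
  -- No solution of `L` occurs: `P` applied to the rational product is a rational function whose
  -- expansion at every point is integral.
  · rw [Multiset.card_eq_zero.1 h0, Multiset.prod_zero, mul_apply, mul_const_apply, mul_one,
      apply_algebraMap, D_apply, deriv_algebraMap, RatFunc.deriv_eq_zero_of_isIntegral, map_zero]
    intro ξ
    rw [← apply_algebraMap]
    refine hP ξ _ (isPuiseux_algebraMap _) ?_
    have := hsol ξ 0 m₂ (by rw [← hm, h0]; simp) (by simp) h₂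
    rwa [Multiset.prod_zero, mul_one] at this
  · obtain ⟨Ld, hLd⟩ : ∃ Ld, L.IsSymPower m₁.card Ld := by
      obtain ⟨d, hd⟩ : ∃ d, m₁.card = d + 1 := ⟨m₁.card - 1, by omega⟩
      rw [hd]
      exact exists_isSymPower hL d
    -- The rational factor stays fixed while the solutions of `L` vary over all multisets of the
    -- same size.
    obtain ⟨A, hA⟩ := hLd.exists_eq_mul hL (hLP OnePoint.infty).determinesOperators
      (fun f hf => hf) (Q := Ns * const m₂.prod) fun m hm' hmL => by
        rw [mul_const_apply]
        exact hsol _ m m₂ (by rw [hm', hm]) hmL h₂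
    obtain ⟨B, hB⟩ := smul_toQuot_eq_zero_iff.1
      (isConstant_of_not_hasPseudoconstant (hno _ hpos (by omega) Ld hLd) (hP.mul_const hA))
    rw [hB, mul_apply, hLd.apply_prod_eq_zero m₁ rfl h₁, apply_zero]
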